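/- **Setting.** Let $F$ be the free group of rank $k\ge 2$ on a fixed free generating set; identify elements of $F$ with reduced words, and write $|v|$ for word length. For $g\in[F,F]$ let $\mathrm{cl}(g)$ be the least number of commutators with product $g$ and $\mathrm{scl}(g)=\lim_{m\to\infty}\mathrm{cl}(g^m)/m$. A function $\varphi:F\to\mathbb R$ is a quasimorphism if $|\varphi(gh)-\varphi(g)-\varphi(h)|$ is bounded; its least upper bound over $g,h\in F$ is the defect $D(\varphi)$. It is homogeneous if moreover $\varphi(g^m)=m\varphi(g)$ for all $g\in F$, $m\in\mathbb Z$. For $S\subset F$ let $c_S(g)$ be the maximal number of disjoint copies of nonempty words of $S$ in the reduced word $g$, let $h_S=c_S-c_{S^{-1}}$ (the small counting quasimorphism), and let $\overline h_S(g)=\lim_{m\to\infty}h_S(g^m)/m$ be its homogenization. **Construction.** Let $\epsilon>0$ and $v\in F$ with $|v|=n$. Put $\ell=\left\lceil(1+\tfrac{\epsilon}{2})\frac{\log n}{\log(2k-1)}\right\rceil$ (for $n\ge 2$), cut the reduced word $v$, starting at its first letter, into adjacent disjoint subwords of length $\ell$ (ignoring a final remainder shorter than $\ell$), and let $S'=S'(v,\epsilon)$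 be the set of those subwords $\sigma$ for which $\sigma^{-1}$ does not occur as a subword of $v$. Put $\varphi_{v,\epsilon}=\overline h_{S'}$. (For $n\le 1$ put $S'=\emptyset$, so $\varphi_{v,\epsilon}=0$.) **Proposition 5.4 (quasimorphism lower bound).** For every $\epsilon>0$ and every $v\in F$, $\varphi_{v,\epsilon}$ is a homogeneous quasimorphism. Moreover, for every $\epsilon>0$ there are constants $C>1$ and $c>0$ (depending only on $k$ and $\epsilon$) such that, for a uniformly random element $v$ of the set of reduced words of length $n$ in $[F,F]$, $n$ even (a set which is nonempty for all large even $n$), with probability $1-O(C^{-n^c})$ as $n\to\infty$ the quasimorphism $\varphi=\varphi_{v,\epsilon}$ has $D(\varphi)>0$ and certifies, via Bavard duality, the lower bound $$\mathrm{scl}(v)\;\ge\;\frac{\varphi(v)}{2D(\varphi)}\;\ge\;\frac1{1+\epsilon}\cdot\frac{n\log(2k-1)}{12\log n}.$$ -/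

import Mathlib

open Filter Topology

namespace RandomScl

noncomputable section

/-! ### Commutator length and stable commutator length -/

section Scl

variable {G : Type*} [Group G]

/-- `g` is a product of `m` commutators. -/
def IsProdOfCommutators (m : ℕ) (g : G) : Prop :=
  ∃ l : List G, l.length = m ∧ (∀ x ∈ l, x ∈ commutatorSet G) ∧ l.prod = g

/-- Commutator length: the least number of commutators whose product is `g`
(meaningful for `g` in the commutator subgroup). -/
def cl (g : G) : ℕ := sInf {m : ℕ | IsProdOfCommutators m g}

/-- Stable commutator length: `scl g = lim_{n → ∞} cl (g ^ n) / n`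
(meaningful for `g` in the commutator subgroup, where the limit exists by `tendsto_scl`). -/
def scl (g : G) : ℝ := limUnder atTop (fun n : ℕ => (cl (g ^ n) : ℝ) / n)

theorem exists_isProdOfCommutators {g : G} (hg : g ∈ commutator G) :
    ∃ m, IsProdOfCommutators m g := by
  rw [commutator_eq_closure] at hg
  induction hg using Subgroup.closure_induction with
  | mem x hx => exact ⟨1, [x], rfl, by simpa using hx, by simp⟩
  | one => exact ⟨0, [], rfl, by simp, rfl⟩
  | mul x y _ _ hx hy =>
    obtain ⟨m, l, h1, h2, h3⟩ := hx
    obtain ⟨m', l', h1', h2', h3'⟩ := hy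
    refine ⟨m + m', l ++ l', by simp [h1, h1'], ?_, by simp [h3, h3']⟩
    intro z hz
    rcases List.mem_append.1 hz with hz | hz
    · exact h2 z hz
    · exact h2' z hz
  | inv x _ hx =>
    obtain ⟨m, l, h1, h2, h3⟩ := hx
    refine ⟨m, (l.map fun z => z⁻¹).reverse, by simp [h1], ?_, ?_⟩
    · intro z hz
      simp only [List.mem_reverse, List.mem_map] at hz
      obtain ⟨w, hw, rfl⟩ := hz
      obtain ⟨a, b, rfl⟩ := h2 w hw
      exact ⟨b, a, (commutatorElement_inv a b).symm⟩
    · rw [← List.prod_inv_reverse, h3]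

theorem isProdOfCommutators_cl {g : G} (hg : g ∈ commutator G) :
    IsProdOfCommutators (cl g) g :=
  Nat.sInf_mem (s := {m : ℕ | IsProdOfCommutators m g}) (exists_isProdOfCommutators hg)

theorem cl_mul_le {g h : G} (hg : g ∈ commutator G) (hh : h ∈ commutator G) :
    cl (g * h) ≤ cl g + cl h := by
  obtain ⟨l, h1, h2, h3⟩ := isProdOfCommutators_cl hg
  obtain ⟨l', h1', h2', h3'⟩ := isProdOfCommutators_cl hh
  refine Nat.sInf_le ⟨l ++ l', by simp [h1, h1'], ?_, by simp [h3, h3']⟩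
  intro z hz
  rcases List.mem_append.1 hz with hz | hz
  · exact h2 z hz
  · exact h2' z hz

/-- On the commutator subgroup the limit that defines `scl` exists. -/
theorem tendsto_scl {g : G} (hg : g ∈ commutator G) :
    Tendsto (fun n : ℕ => (cl (g ^ n) : ℝ) / n) atTop (𝓝 (scl g)) := by
  have hsub : Subadditive (fun n : ℕ => (cl (g ^ n) : ℝ)) := by
    intro m n
    dsimp only
    rw [pow_add]
    exact_mod_cast cl_mul_le (Subgroup.pow_mem _ hg m) (Subgroup.pow_mem _ hg n)
  refine tendsto_nhds_limUnder ⟨_, hsub.tendsto_lim ⟨0, ?_⟩⟩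
  rintro _ ⟨n, rfl⟩
  positivity

end Scl

/-! ### Quasimorphisms -/

section Quasimorphism

variable {G : Type*} [Group G]

/-- `φ : G → ℝ` is a quasimorphism: `|φ (g h) - φ g - φ h|` is bounded. -/
def IsQuasimorphism (φ : G → ℝ) : Prop :=
  ∃ D : ℝ, ∀ g h : G, |φ (g * h) - φ g - φ h| ≤ D

/-- The defect `D(φ)`: the least `D` with `|φ (g h) - φ g - φ h| ≤ D` for all `g`, `h`. -/
def defect (φ : G → ℝ) : ℝ :=
  sInf {D : ℝ | ∀ g h : G, |φ (g * h) - φ g - φ h| ≤ D}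

/-- For a quasimorphism the infimum in the definition of the defect is attained. -/
theorem IsQuasimorphism.abs_le_defect {φ : G → ℝ} (hφ : IsQuasimorphism φ) (g h : G) :
    |φ (g * h) - φ g - φ h| ≤ defect φ :=
  le_csInf hφ fun _ hD => hD g h

/-- A quasimorphism that satisfies `φ (g ^ n) = n φ g` for all integers `n`. -/
def IsHomogeneousQuasimorphism (φ : G → ℝ) : Prop :=
  IsQuasimorphism φ ∧ ∀ (g : G) (n : ℤ), φ (g ^ n) = n * φ g

/-- The homogenization `g ↦ lim_{n → ∞} φ (g ^ n) / n`
(the limit exists for every quasimorphism by `tendsto_homogenization`). -/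
def homogenization (φ : G → ℝ) (g : G) : ℝ :=
  limUnder atTop (fun n : ℕ => φ (g ^ n) / n)

theorem tendsto_homogenization {φ : G → ℝ} (hφ : IsQuasimorphism φ) (g : G) :
    Tendsto (fun n : ℕ => φ (g ^ n) / n) atTop (𝓝 (homogenization φ g)) := by
  obtain ⟨D, hD⟩ := hφ
  have hD0 : 0 ≤ D := (abs_nonneg _).trans (hD 1 1)
  have hsub : Subadditive (fun n : ℕ => φ (g ^ n) + D) := by
    intro m n
    have := (abs_le.1 (hD (g ^ m) (g ^ n))).2
    rw [← pow_add] at this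
    dsimp only
    linarith
  have hlow : ∀ n : ℕ, -(|φ g| + |φ 1| + D) * n + φ 1 ≤ φ (g ^ n) := by
    intro n
    induction n with
    | zero => simp
    | succ n ih =>
      have h1 := (abs_le.1 (hD (g ^ n) g)).1
      rw [← pow_succ] at h1
      have h2 := neg_abs_le (φ g)
      have h3 := abs_nonneg (φ 1)
      push_cast
      linarith
  have hlim := hsub.tendsto_lim ⟨-(|φ g| + |φ 1| + D) - |φ 1|, by
    rintro _ ⟨n, rfl⟩
    rcases Nat.eq_zero_or_pos n with rfl | hn
    · have h1 := abs_nonneg (φ g)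
      have h2 := abs_nonneg (φ 1)
      simp
      linarith
    · have hn' : (1 : ℝ) ≤ n := by exact_mod_cast hn
      dsimp only
      rw [le_div_iff₀ (by linarith)]
      have h1 := hlow n
      have h2 := neg_abs_le (φ 1)
      have h3 := mul_le_mul_of_nonneg_left hn' (abs_nonneg (φ 1))
      linarith⟩
  refine tendsto_nhds_limUnder ⟨hsub.lim, ?_⟩
  have hz : Tendsto (fun n : ℕ => D / (n : ℝ)) atTop (𝓝 0) :=
    tendsto_const_div_atTop_nhds_zero_nat D
  have hsum := hlim.sub hz
  rw [sub_zero] at hsum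
  refine hsum.congr fun n => ?_
  rw [← sub_div, add_sub_cancel_right]

end Quasimorphism

/-! ### Subwords and small counting quasimorphisms -/

section Counting

variable {α : Type*} [DecidableEq α]

/-- The reduced word of `σ` occurs in the reduced word of `v`, starting after `i` letters. -/
def IsCopyAt (σ v : FreeGroup α) (i : ℕ) : Prop :=
  σ.toWord <+: v.toWord.drop i

/-- The reduced word of `σ` occurs somewhere as a subword of the reduced word of `v`. -/
def Appears (σ v : FreeGroup α) : Prop := σ.toWord <:+: v.toWord

/-- `P` is a set of disjoint copies in `v` of (nonempty) words in `S`; the pair `(i, σ)` stands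
for the copy of `σ` that occupies the positions `i, …, i + |σ| - 1` of `v`. -/
def IsDisjointCopies (S : Set (FreeGroup α)) (v : FreeGroup α)
    (P : Finset (ℕ × FreeGroup α)) : Prop :=
  (∀ p ∈ P, p.2 ∈ S ∧ p.2 ≠ 1 ∧ IsCopyAt p.2 v p.1) ∧
  ∀ p ∈ P, ∀ q ∈ P, p ≠ q →
    Disjoint (Finset.Ico p.1 (p.1 + p.2.norm)) (Finset.Ico q.1 (q.1 + q.2.norm))

/-- `c_S(v)`: the maximal number of disjoint copies of elements of `S` in `v`. -/
def smallCount (S : Set (FreeGroup α)) (v : FreeGroup α) : ℕ :=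
  sSup {r : ℕ | ∃ P, IsDisjointCopies S v P ∧ P.card = r}

theorem IsDisjointCopies.card_le {S : Set (FreeGroup α)} {v : FreeGroup α}
    {P : Finset (ℕ × FreeGroup α)} (hP : IsDisjointCopies S v P) : P.card ≤ v.norm := by
  have hpos : ∀ p ∈ P, 0 < p.2.norm := fun p hp =>
    Nat.pos_of_ne_zero fun h => (hP.1 p hp).2.1 (FreeGroup.norm_eq_zero.1 h)
  rw [← Finset.card_range v.norm]
  refine Finset.card_le_card_of_injOn Prod.fst ?_ ?_
  · intro p hp
    have h1 := (hP.1 p hp).2.2.length_le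
    have h2 := hpos p hp
    rw [List.length_drop] at h1
    simp only [FreeGroup.norm] at h2 ⊢
    simp only [Finset.coe_range, Set.mem_Iio]
    omega
  · intro p hp q hq hpq
    by_contra hne
    have h1 := hpos p hp
    have h2 := hpos q hq
    have hd := hP.2 p hp q hq hne
    rw [Finset.disjoint_left] at hd
    refine @hd p.1 (by simp [h1]) ?_
    rw [hpq]
    simp [h2]

/-- The supremum in the definition of `smallCount` is a maximum. -/
theorem isGreatest_smallCount (S : Set (FreeGroup α)) (v : FreeGroup α) :
    IsGreatest {r : ℕ | ∃ P, IsDisjointCopies S v P ∧ P.card = r} (smallCount S v) := by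
  have hb : BddAbove {r : ℕ | ∃ P, IsDisjointCopies S v P ∧ P.card = r} :=
    ⟨v.norm, by rintro _ ⟨P, hP, rfl⟩; exact hP.card_le⟩
  exact ⟨Nat.sSup_mem ⟨0, ∅, by simp [IsDisjointCopies], rfl⟩ hb, fun _ hr => le_csSup hb hr⟩

/-- The small counting quasimorphism `h_S = c_S - c_{S⁻¹}`. -/
def smallCountingQM (S : Set (FreeGroup α)) (v : FreeGroup α) : ℝ :=
  (smallCount S v : ℝ) - (smallCount {σ | σ⁻¹ ∈ S} v : ℝ)

/-- The words of the adjacent disjoint blocks of length `ℓ` into which `v` is cut, beginning with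
its first letter; the final remainder, shorter than `ℓ`, is ignored. -/
def blocks (ℓ : ℕ) (v : FreeGroup α) : Set (FreeGroup α) :=
  {σ | ∃ j : ℕ, (j + 1) * ℓ ≤ v.norm ∧ σ.toWord = (v.toWord.drop (j * ℓ)).take ℓ}

/-- The blocks of `v` whose inverses do not occur in `v`. -/
def uncancelledBlocks (ℓ : ℕ) (v : FreeGroup α) : Set (FreeGroup α) :=
  {σ ∈ blocks ℓ v | ¬ Appears σ⁻¹ v}

end Counting

/-! ### The construction and the probability model -/

/-- The block length `(1 + ε / 2) log n / log (2k - 1)`, rounded up. -/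
def blockLength (k : ℕ) (ε : ℝ) (n : ℕ) : ℕ :=
  ⌈(1 + ε / 2) * (Real.log n / Real.log (2 * k - 1))⌉₊

/-- The homogenized small counting quasimorphism on the set of those blocks of `v`,
of length `(1 + ε / 2) log |v| / log (2k - 1)`, whose inverses do not occur in `v`. -/
def certifyingQM {k : ℕ} (ε : ℝ) (v : FreeGroup (Fin k)) : FreeGroup (Fin k) → ℝ :=
  homogenization (smallCountingQM (uncancelledBlocks (blockLength k ε v.norm) v))

/-- The elements of word length `n` in the commutator subgroup of the free group of rank `k`. -/
def commutatorSphere (k n : ℕ) : Set (FreeGroup (Fin k)) :=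
  {v | v.norm = n ∧ v ∈ commutator (FreeGroup (Fin k))}

theorem finite_commutatorSphere (k n : ℕ) : (commutatorSphere k n).Finite :=
  ((List.finite_length_eq (Fin k × Bool) n).preimage
    FreeGroup.toWord_injective.injOn).subset fun _ hv => hv.1

/-- The probability of `E` for a uniformly distributed random element of the finite nonempty
set `A`. -/
def uniformProb {β : Type*} (A E : Set β) : ℝ := ((A ∩ E).ncard : ℝ) / (A.ncard : ℝ)

end

end RandomScl

/-!
The construction is certified by three independent facts.

*Defects.* A small counting quasimorphism `h_S` is antisymmetric, and cutting a reduced word in two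
changes it by at most `1` (`abs_smallCountingQM_sub_le`), so its defect is at most `3`. Homogenizing
an antisymmetric quasimorphism at most doubles the defect (`abs_homogenization_mul_sub_le`), so the
defect of `φ = certifyingQM ε v` is at most `6`, for every `v`. The second inequality of the
conclusion is the easy half of Bavard duality
(`IsHomogeneousQuasimorphism.le_two_mul_defect_mul_scl`).

*The value at `v`.* Let `ℓ` be the block length. No inverse of an uncancelled block occurs in `v`,
and `φ` differs from the counting quasimorphism by at most `3`. Hence `φ v` is at least `n / ℓ - 3`
minus the number of cancelled blocks, those whose inverses occur in `v`
(`le_homogenization_smallCountingQM`). Comparing with the bound `φ v / 12`, it remains to show that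
with overwhelming probability only a small proportion of the blocks is cancelled.

*Few cancelled blocks.* A block and an occurrence of its inverse in a reduced word are disjoint, so
every cancelled block is determined by the letters before it or by the letters after it. Specifying
`r` cancelled blocks of one kind and the positions of their inverses costs at most
`2 ^ (n / ℓ) * n ^ r` choices, and reduces the number of words by the factor
`(2k - 1) ^ (r * ℓ) ≥ n ^ ((1 + ε / 2) * r)` (`card_filter_cancelledIndices_mul_le`). When `r` is
proportional to `n / log n`, the factor `n ^ (ε * r / 2)` that remains is exponential in `n`.
Restricting to the commutator subgroup costs only a polynomial factor, because reduced words
`L₁ [y, x] L₂⁻¹`, with `L₂` a permutation of `L₁`, lie in it and are numerous by the pigeonhole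
principle (`pow_le_ncard_commutatorSphere`). Thus the exceptional probability is `O(C ^ (-n))`, and
the exponent `c = 1` can be taken.
-/

namespace RandomScl

/-! ### Homogenization, defects and Bavard duality -/

section Quasi

variable {G : Type*} [Group G] {φ : G → ℝ} {D : ℝ}

theorem abs_map_pow_sub_le (hD : ∀ g h : G, |φ (g * h) - φ g - φ h| ≤ D) (g : G) (n : ℕ) :
    |φ (g ^ (n + 1)) - (n + 1 : ℕ) * φ g| ≤ n * D := by
  induction n with
  | zero => simp
  | succ n ih =>
    have h1 := abs_le.1 (hD (g ^ (n + 1)) g)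
    rw [← pow_succ] at h1
    have h2 := abs_le.1 ih
    rw [abs_le]
    push_cast at *
    constructor <;> linarith

theorem abs_homogenization_sub_le (hD : ∀ g h : G, |φ (g * h) - φ g - φ h| ≤ D) (g : G) :
    |homogenization φ g - φ g| ≤ D := by
  have hD0 : 0 ≤ D := (abs_nonneg _).trans (hD 1 1)
  have ht := ((tendsto_homogenization ⟨D, hD⟩ g).sub_const (φ g)).abs
  refine le_of_tendsto ht ?_
  filter_upwards [eventually_ge_atTop 1] with n hn
  obtain ⟨m, rfl⟩ : ∃ m, n = m + 1 := ⟨n - 1, by omega⟩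
  have hpos : (0 : ℝ) < (m + 1 : ℕ) := by positivity
  rw [div_sub' hpos.ne', abs_div, abs_of_pos hpos, div_le_iff₀ hpos]
  refine (abs_map_pow_sub_le hD g m).trans ?_
  push_cast
  nlinarith

theorem homogenization_pow (hφ : IsQuasimorphism φ) (g : G) (m : ℕ) :
    homogenization φ (g ^ m) = m * homogenization φ g := by
  rcases Nat.eq_zero_or_pos m with rfl | hm
  · have h := tendsto_homogenization hφ (1 : G)
    simp only [one_pow] at h
    simpa using tendsto_nhds_unique h (tendsto_const_div_atTop_nhds_zero_nat (φ 1))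
  have h1 := tendsto_homogenization hφ (g ^ m)
  have h2 := ((tendsto_homogenization hφ g).comp
    (tendsto_id.const_mul_atTop' hm : Tendsto (fun n : ℕ => m * n) atTop atTop)).const_mul (m : ℝ)
  refine tendsto_nhds_unique h1 (h2.congr fun n => ?_)
  have : (m : ℝ) ≠ 0 := by positivity
  simp only [Function.comp, pow_mul, Nat.cast_mul]
  rw [← mul_div_assoc, mul_div_mul_left _ _ this]

theorem homogenization_zpow (hφ : IsQuasimorphism φ) (hanti : ∀ g, φ g⁻¹ = -φ g) (g : G)
    (m : ℤ) : homogenization φ (g ^ m) = m * homogenization φ g := by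
  obtain ⟨n, rfl | rfl⟩ := m.eq_nat_or_neg
  · simpa using homogenization_pow hφ g n
  · have h : homogenization φ (g ^ n)⁻¹ = -homogenization φ (g ^ n) := by
      refine tendsto_nhds_unique (tendsto_homogenization hφ _)
        ((tendsto_homogenization hφ (g ^ n)).neg.congr fun i => ?_)
      rw [inv_pow, hanti, neg_div]
    simp [h, homogenization_pow hφ g n]

/-- Homogenizing an antisymmetric quasimorphism at most doubles the defect. A pair of pants whose
boundary represents `a`, `b`, `(ab)⁻¹` is cut into two ideal triangles spiralling into the
boundary; each contributes at most `D`. To stay with elements of the group, the spiralling ends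
are replaced by the powers `a ^ i`, `b ^ j`, `(ab) ^ j`, and the contributions are averaged over
`0 ≤ i, j < N`. -/
theorem abs_homogenization_mul_sub_le (hD : ∀ g h : G, |φ (g * h) - φ g - φ h| ≤ D)
    (hanti : ∀ g, φ g⁻¹ = -φ g) (a b : G) :
    |homogenization φ (a * b) - homogenization φ a - homogenization φ b| ≤ 2 * D := by
  have hD0 : 0 ≤ D := (abs_nonneg _).trans (hD 1 1)
  set ψ := homogenization φ with hψ
  set d := a * b with hd
  -- `f` is the invariant 1-cochain of `φ`: antisymmetric, with coboundary at most `D`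
  let f : G → G → ℝ := fun x y => φ (x⁻¹ * y)
  have hf : ∀ x y, f y x = -f x y := fun x y => by
    simp only [f]; rw [← hanti, mul_inv_rev, inv_inv]
  have hinv : ∀ g x y, f (g * x) (g * y) = f x y := fun g x y => by
    simp only [f]; congr 1; group
  have htri : ∀ x y z, |f x y + f y z + f z x| ≤ D := fun x y z => by
    have h := hD (x⁻¹ * y) (y⁻¹ * z)
    rw [show x⁻¹ * y * (y⁻¹ * z) = x⁻¹ * z by group] at h
    rw [hf x z, ← abs_neg]
    simp only [f]
    convert h using 2
    ring
  let u : ℕ → ℝ := fun j => f (b ^ j) (d ^ j)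
  have hcell : ∀ i j : ℕ, |(f (a ^ (i + 1)) (b ^ (j + 1)) - f (a ^ i) (b ^ (j + 1))) +
      (u (j + 1) - u j)| ≤ 2 * D := by
    intro i j
    -- The two triangles share the edge from `a ^ (i + 1)` to `d ^ (j + 1)`. Translation by `a⁻¹`
    -- and `d⁻¹` turns the remaining edges of the second into edges of neighbours of the first.
    have h1 := htri (a ^ (i + 1)) (b ^ (j + 1)) (d ^ (j + 1))
    have h2 := htri (a ^ (i + 1)) (d ^ (j + 1)) (a * b ^ (j + 1))
    have e1 : f (d ^ (j + 1)) (a * b ^ (j + 1)) = -u j := by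
      rw [pow_succ' d, pow_succ' b, ← mul_assoc, ← hd, hinv, hf]
    have e2 : f (a * b ^ (j + 1)) (a ^ (i + 1)) = -f (a ^ i) (b ^ (j + 1)) := by
      rw [pow_succ' a, hinv, hf]
    rw [e1, e2] at h2
    rw [hf (a ^ (i + 1)) (d ^ (j + 1))] at h1
    have h3 : u (j + 1) = f (b ^ (j + 1)) (d ^ (j + 1)) := rfl
    rw [← h3] at h1
    rw [abs_le] at *
    constructor <;> linarith [h1.1, h1.2, h2.1, h2.2]
  have hclose : ∀ g, |ψ g - φ g| ≤ D := abs_homogenization_sub_le hD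
  have hpow : ∀ (g : G) (n : ℕ), ψ (g ^ n) = n * ψ g := homogenization_pow ⟨D, hD⟩
  have hone : φ 1 = 0 := by have := hanti 1; rw [inv_one] at this; linarith
  -- both brackets in `hcell` telescope when summed over `i` and over `j`
  have hN : ∀ N : ℕ, N * |ψ d - ψ a - ψ b| ≤ N * (2 * D) + 5 * D := by
    intro N
    rcases Nat.eq_zero_or_pos N with rfl | hNpos
    · simp; positivity
    have hNr : (0 : ℝ) < N := by exact_mod_cast hNpos
    have hrow : ∀ j : ℕ, |N * (u (j + 1) - u j) - N * ψ a| ≤ N * (2 * D) + 2 * D := by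
      intro j
      have hsum : |∑ i ∈ Finset.range N, ((f (a ^ (i + 1)) (b ^ (j + 1)) -
          f (a ^ i) (b ^ (j + 1))) + (u (j + 1) - u j))| ≤ N * (2 * D) := by
        refine (Finset.abs_sum_le_sum_abs _ _).trans ?_
        refine (Finset.sum_le_sum fun i _ => hcell i j).trans ?_
        simp
      rw [Finset.sum_add_distrib, Finset.sum_range_sub (fun i => f (a ^ i) (b ^ (j + 1)))] at hsum
      simp only [Finset.sum_const, Finset.card_range, nsmul_eq_mul, pow_zero] at hsum
      have h1 := htri (a ^ N) (b ^ (j + 1)) 1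
      have h2 : f 1 (a ^ N) = φ (a ^ N) := by simp [f]
      have h3 := hclose (a ^ N)
      rw [hpow] at h3
      rw [hf 1 (b ^ (j + 1)), h2] at h1
      rw [abs_le] at *
      constructor <;> linarith [h1.1, h1.2, h3.1, h3.2, hsum.1, hsum.2]
    have htot : |∑ j ∈ Finset.range N, (N * (u (j + 1) - u j) - N * ψ a)|
        ≤ N * (N * (2 * D) + 2 * D) := by
      refine (Finset.abs_sum_le_sum_abs _ _).trans ?_
      refine (Finset.sum_le_sum fun j _ => hrow j).trans ?_
      rw [Finset.sum_const, Finset.card_range, nsmul_eq_mul]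
    rw [Finset.sum_sub_distrib, ← Finset.mul_sum, Finset.sum_range_sub] at htot
    simp only [Finset.sum_const, Finset.card_range, nsmul_eq_mul] at htot
    rw [← mul_sub, abs_mul, abs_of_pos hNr] at htot
    have htot' := le_of_mul_le_mul_left htot hNr
    have hu0 : u 0 = 0 := by simp [u, f, hone]
    have huN := htri (b ^ N) (d ^ N) 1
    have h1 : f 1 (b ^ N) = φ (b ^ N) := by simp [f]
    have h2 : f (d ^ N) 1 = -φ (d ^ N) := by rw [hf 1]; simp [f]
    have h3 := hclose (b ^ N)
    have h4 := hclose (d ^ N)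
    rw [hpow] at h3 h4
    rw [h1, h2] at huN
    rw [← abs_of_pos hNr, ← abs_mul, abs_of_pos hNr]
    have hu : u N = f (b ^ N) (d ^ N) := rfl
    rw [← hu] at huN
    rw [hu0] at htot'
    rw [abs_le] at *
    constructor <;> nlinarith [huN.1, huN.2, h3.1, h3.2, h4.1, h4.2, htot'.1, htot'.2]
  -- divide by `N` and let `N → ∞`
  have hlim : Tendsto (fun N : ℕ => 2 * D + 5 * D / (N : ℝ)) atTop (𝓝 (2 * D + 0)) :=
    (tendsto_const_div_atTop_nhds_zero_nat (5 * D)).const_add _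
  rw [add_zero] at hlim
  refine ge_of_tendsto hlim ?_
  filter_upwards [eventually_ge_atTop 1] with N hNpos
  have hNr : (0 : ℝ) < N := by exact_mod_cast hNpos
  have := hN N
  rw [← sub_nonneg] at this ⊢
  have e : 2 * D + 5 * D / N - |ψ d - ψ a - ψ b| =
      (N * (2 * D) + 5 * D - N * |ψ d - ψ a - ψ b|) / N := by field_simp
  rw [e]
  positivity

theorem isHomogeneousQuasimorphism_homogenization (hφ : IsQuasimorphism φ)
    (hanti : ∀ g, φ g⁻¹ = -φ g) : IsHomogeneousQuasimorphism (homogenization φ) := by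
  refine ⟨?_, homogenization_zpow hφ hanti⟩
  obtain ⟨D, hD⟩ := hφ
  exact ⟨2 * D, abs_homogenization_mul_sub_le hD hanti⟩

theorem IsQuasimorphism.defect_nonneg (hφ : IsQuasimorphism φ) : 0 ≤ defect φ :=
  (abs_nonneg _).trans (hφ.abs_le_defect 1 1)

theorem defect_le (hD : ∀ g h : G, |φ (g * h) - φ g - φ h| ≤ D) : defect φ ≤ D :=
  csInf_le ⟨0, fun _ h => (abs_nonneg _).trans (h 1 1)⟩ hD

theorem IsHomogeneousQuasimorphism.map_inv (hφ : IsHomogeneousQuasimorphism φ) (g : G) :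
    φ g⁻¹ = -φ g := by
  simpa using hφ.2 g (-1)

theorem IsHomogeneousQuasimorphism.map_conj (hφ : IsHomogeneousQuasimorphism φ) (g x : G) :
    φ (g * x * g⁻¹) = φ x := by
  set K := 2 * defect φ with hK
  have hpow : ∀ (y : G) (n : ℕ), φ (y ^ n) = n * φ y := fun y n => by
    simpa using hφ.2 y n
  -- conjugation changes `φ (x ^ n)` by a bounded amount, but `n` times the difference at `x`
  have hb : ∀ n : ℕ, n * |φ (g * x * g⁻¹) - φ x| ≤ K := by
    intro n
    rw [← Nat.abs_cast n, ← abs_mul, mul_sub, ← hpow, ← hpow, conj_pow]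
    have h1 := abs_le.1 (hφ.1.abs_le_defect (g * x ^ n) g⁻¹)
    have h2 := abs_le.1 (hφ.1.abs_le_defect g (x ^ n))
    rw [hφ.map_inv] at h1
    rw [abs_le]
    constructor <;> linarith [h1.1, h1.2, h2.1, h2.2]
  by_contra hne
  have hpos : 0 < |φ (g * x * g⁻¹) - φ x| := abs_pos.2 (sub_ne_zero.2 hne)
  obtain ⟨n, hn⟩ := exists_nat_gt (K / |φ (g * x * g⁻¹) - φ x|)
  rw [div_lt_iff₀ hpos] at hn
  exact absurd (hb n) (not_le.2 hn)

theorem IsHomogeneousQuasimorphism.map_commutator_le (hφ : IsHomogeneousQuasimorphism φ) {x : G}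
    (hx : x ∈ commutatorSet G) : φ x ≤ defect φ := by
  obtain ⟨a, b, rfl⟩ := hx
  have h := (abs_le.1 (hφ.1.abs_le_defect a (b * a⁻¹ * b⁻¹))).2
  rw [hφ.map_conj, hφ.map_inv] at h
  rw [commutatorElement_def, show a * b * a⁻¹ * b⁻¹ = a * (b * a⁻¹ * b⁻¹) by group]
  linarith

theorem IsHomogeneousQuasimorphism.le_two_mul_cl (hφ : IsHomogeneousQuasimorphism φ) {g : G}
    (hg : g ∈ commutator G) : φ g ≤ cl g * (2 * defect φ) := by
  obtain ⟨l, hl, hc, rfl⟩ := isProdOfCommutators_cl hg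
  rw [← hl]
  clear hl hg
  induction l with
  | nil =>
    have := hφ.2 1 0
    simp at this
    simp [this]
  | cons x l ih =>
    have h1 := ih fun y hy => hc y (List.mem_cons_of_mem _ hy)
    have h2 := hφ.map_commutator_le (hc x List.mem_cons_self)
    have h3 := (abs_le.1 (hφ.1.abs_le_defect x l.prod)).2
    rw [List.prod_cons, List.length_cons]
    push_cast
    linarith

/-- The easy half of Bavard duality. -/
theorem IsHomogeneousQuasimorphism.le_two_mul_defect_mul_scl (hφ : IsHomogeneousQuasimorphism φ)
    {g : G} (hg : g ∈ commutator G) : φ g ≤ scl g * (2 * defect φ) := by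
  refine ge_of_tendsto ((tendsto_scl hg).mul_const (2 * defect φ)) ?_
  filter_upwards [eventually_ge_atTop 1] with n hn
  have hnr : (0 : ℝ) < n := by exact_mod_cast hn
  have h1 := hφ.le_two_mul_cl (Subgroup.pow_mem _ hg n)
  have h2 : φ (g ^ n) = n * φ g := by simpa using hφ.2 g n
  rw [h2] at h1
  rw [div_mul_eq_mul_div, le_div_iff₀ hnr]
  linarith

/-- A homogeneous quasimorphism that is positive at an element of the commutator subgroup is not a
homomorphism. -/
theorem IsHomogeneousQuasimorphism.defect_pos (hφ : IsHomogeneousQuasimorphism φ)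
    {g : G} (hg : g ∈ commutator G) (hpos : 0 < φ g) : 0 < defect φ := by
  refine lt_of_le_of_ne hφ.1.defect_nonneg fun h => ?_
  have := hφ.le_two_mul_defect_mul_scl hg
  rw [← h] at this
  linarith

end Quasi

/-! ### Small counting quasimorphisms -/

theorem disjoint_Ico_add_iff {a b l m : ℕ} (hl : 0 < l) (hm : 0 < m) :
    Disjoint (Finset.Ico a (a + l)) (Finset.Ico b (b + m)) ↔ a + l ≤ b ∨ b + m ≤ a := by
  rw [Finset.disjoint_left]
  constructor
  · intro h
    by_contra! hc
    have := @h (max a b) (by simp; omega)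
    simp at this
    omega
  · intro h x
    simp
    omega

section Counting

variable {α : Type*}

theorem isReduced_invRev {L : List (α × Bool)} (h : FreeGroup.IsReduced L) :
    FreeGroup.IsReduced (FreeGroup.invRev L) := by
  classical
  rw [FreeGroup.isReduced_iff_reduce_eq, FreeGroup.reduce_invRev, h.reduce_eq]

/-- Maximal cancellation between two reduced words. -/
theorem exists_cancellation {L₁ L₂ : List (α × Bool)} (h₁ : FreeGroup.IsReduced L₁)
    (h₂ : FreeGroup.IsReduced L₂) :
    ∃ X Y Z, L₁ = X ++ Y ∧ L₂ = FreeGroup.invRev Y ++ Z ∧ FreeGroup.IsReduced (X ++ Z) := by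
  induction L₁ using List.reverseRecOn generalizing L₂ with
  | nil => exact ⟨[], [], L₂, rfl, rfl, h₂⟩
  | append_singleton L a ih =>
    cases L₂ with
    | nil => exact ⟨L ++ [a], [], [], by simp, rfl, by simpa using h₁⟩
    | cons b M =>
      by_cases hab : a.1 = b.1 → a.2 = b.2
      · refine ⟨L ++ [a], [], b :: M, by simp, rfl, ?_⟩
        have : FreeGroup.IsReduced ([a] ++ (b :: M)) :=
          FreeGroup.isReduced_cons_cons.2 ⟨hab, h₂⟩
        simpa using h₁.append_overlap this (by simp)
      · push Not at hab
        obtain ⟨X, Y, Z, rfl, rfl, hred⟩ := ih (h₁.infix (List.infix_append' [] L [a]))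
          (h₂.infix (List.suffix_cons b M).isInfix)
        refine ⟨X, Y ++ [a], Z, by simp, ?_, hred⟩
        rw [FreeGroup.invRev_append]
        have : b = (a.1, !a.2) := by
          ext
          · exact hab.1.symm
          · exact Bool.eq_not_of_ne hab.2.symm
        simp [FreeGroup.invRev, this]

/-- The `j`-th block of length `ℓ` of a word. -/
def blockWord (ℓ : ℕ) (L : List (α × Bool)) (j : ℕ) : List (α × Bool) :=
  (L.drop (j * ℓ)).take ℓ

theorem blockWord_infix (ℓ : ℕ) (L : List (α × Bool)) (j : ℕ) : blockWord ℓ L j <:+: L :=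
  (List.take_prefix _ _).isInfix.trans (List.drop_suffix _ _).isInfix

theorem length_blockWord {ℓ j : ℕ} {L : List (α × Bool)} (h : j < L.length / ℓ) :
    (blockWord ℓ L j).length = ℓ := by
  have h1 : (j + 1) * ℓ ≤ L.length :=
    (Nat.mul_le_mul_right _ h).trans (Nat.div_mul_le_self _ _)
  rw [add_mul, one_mul] at h1
  rw [blockWord, List.length_take, List.length_drop]
  omega

variable [DecidableEq α]

theorem norm_pos {σ : FreeGroup α} (h : σ ≠ 1) : 0 < σ.norm :=
  Nat.pos_of_ne_zero fun h' => h (FreeGroup.norm_eq_zero.1 h')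

theorem IsCopyAt.add_norm_le {σ v : FreeGroup α} {i : ℕ} (h : IsCopyAt σ v i) (hσ : σ ≠ 1) :
    i + σ.norm ≤ v.norm := by
  have h1 := h.length_le
  have h2 := norm_pos hσ
  rw [List.length_drop] at h1
  simp only [FreeGroup.norm] at *
  omega

theorem IsDisjointCopies.separated {S : Set (FreeGroup α)} {v : FreeGroup α}
    {P : Finset (ℕ × FreeGroup α)} (hP : IsDisjointCopies S v P) {p q : ℕ × FreeGroup α}
    (hp : p ∈ P) (hq : q ∈ P) (hpq : p ≠ q) :
    p.1 + p.2.norm ≤ q.1 ∨ q.1 + q.2.norm ≤ p.1 :=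
  (disjoint_Ico_add_iff (norm_pos (hP.1 p hp).2.1) (norm_pos (hP.1 q hq).2.1)).1
    (hP.2 p hp q hq hpq)

theorem isDisjointCopies_of_separated {S : Set (FreeGroup α)} {v : FreeGroup α}
    {P : Finset (ℕ × FreeGroup α)} (h : ∀ p ∈ P, p.2 ∈ S ∧ p.2 ≠ 1 ∧ IsCopyAt p.2 v p.1)
    (hsep : ∀ p ∈ P, ∀ q ∈ P, p ≠ q → p.1 + p.2.norm ≤ q.1 ∨ q.1 + q.2.norm ≤ p.1) :
    IsDisjointCopies S v P :=
  ⟨h, fun p hp q hq hpq => (disjoint_Ico_add_iff (norm_pos (h p hp).2.1)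
    (norm_pos (h q hq).2.1)).2 (hsep p hp q hq hpq)⟩

theorem IsDisjointCopies.card_le_smallCount {S : Set (FreeGroup α)} {v : FreeGroup α}
    {P : Finset (ℕ × FreeGroup α)} (hP : IsDisjointCopies S v P) : P.card ≤ smallCount S v :=
  (isGreatest_smallCount S v).2 ⟨P, hP, rfl⟩

theorem exists_isDisjointCopies (S : Set (FreeGroup α)) (v : FreeGroup α) :
    ∃ P, IsDisjointCopies S v P ∧ P.card = smallCount S v :=
  (isGreatest_smallCount S v).1

section Append

variable {x z w σ : FreeGroup α} {i : ℕ}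

theorem IsCopyAt.append_left (hw : w.toWord = x.toWord ++ z.toWord) (h : IsCopyAt σ x i) :
    IsCopyAt σ w i := by
  rw [IsCopyAt, hw, List.drop_append]
  exact h.trans (List.prefix_append _ _)

theorem isCopyAt_add_norm_iff (hw : w.toWord = x.toWord ++ z.toWord) :
    IsCopyAt σ w (x.norm + i) ↔ IsCopyAt σ z i := by
  rw [IsCopyAt, IsCopyAt, hw, FreeGroup.norm, List.drop_length_add_append]

theorem IsCopyAt.of_append_left (hw : w.toWord = x.toWord ++ z.toWord) (h : IsCopyAt σ w i)
    (hi : i + σ.norm ≤ x.norm) : IsCopyAt σ x i := by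
  rw [IsCopyAt, hw, List.drop_append] at h
  refine List.prefix_of_prefix_length_le h (List.prefix_append _ _) ?_
  rw [List.length_drop]
  simp only [FreeGroup.norm] at hi
  omega

theorem smallCount_add_le (S : Set (FreeGroup α)) (hw : w.toWord = x.toWord ++ z.toWord) :
    smallCount S x + smallCount S z ≤ smallCount S w := by
  obtain ⟨P, hP, hPc⟩ := exists_isDisjointCopies S x
  obtain ⟨Q, hQ, hQc⟩ := exists_isDisjointCopies S z
  set f : ℕ × FreeGroup α → ℕ × FreeGroup α := fun p => (x.norm + p.1, p.2)
  have hf : Function.Injective f := by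
    rintro ⟨a, b⟩ ⟨c, d⟩ h
    simpa [f] using h
  have hx : ∀ p ∈ P, p.1 + p.2.norm ≤ x.norm := fun p hp =>
    (hP.1 p hp).2.2.add_norm_le (hP.1 p hp).2.1
  have hdisj : Disjoint P (Q.image f) := by
    rw [Finset.disjoint_left]
    intro p hp hq
    obtain ⟨q, -, rfl⟩ := Finset.mem_image.1 hq
    have h1 := hx _ hp
    have h2 := norm_pos (hP.1 _ hp).2.1
    simp only [f] at h1 h2
    omega
  rw [← hPc, ← hQc, ← Finset.card_image_of_injective Q hf, ← Finset.card_union_of_disjoint hdisj]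
  refine IsDisjointCopies.card_le_smallCount (isDisjointCopies_of_separated ?_ ?_)
  · intro p hp
    rcases Finset.mem_union.1 hp with hp | hp
    · exact ⟨(hP.1 p hp).1, (hP.1 p hp).2.1, (hP.1 p hp).2.2.append_left hw⟩
    · obtain ⟨q, hq, rfl⟩ := Finset.mem_image.1 hp
      exact ⟨(hQ.1 q hq).1, (hQ.1 q hq).2.1, (isCopyAt_add_norm_iff hw).2 (hQ.1 q hq).2.2⟩
  · intro p hp q hq hpq
    rcases Finset.mem_union.1 hp with hp | hp <;> rcases Finset.mem_union.1 hq with hq | hq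
    · exact hP.separated hp hq hpq
    · obtain ⟨q, hq, rfl⟩ := Finset.mem_image.1 hq
      have := hx p hp
      simp only [f]
      omega
    · obtain ⟨p, hp, rfl⟩ := Finset.mem_image.1 hp
      have := hx q hq
      simp only [f]
      omega
    · obtain ⟨q, hq₀, rfl⟩ := Finset.mem_image.1 hq
      obtain ⟨p, hp₀, rfl⟩ := Finset.mem_image.1 hp
      have := hQ.separated hp₀ hq₀ fun h => hpq (h ▸ rfl)
      simp only [f]
      omega

theorem IsDisjointCopies.subset {S : Set (FreeGroup α)} {v : FreeGroup α}
    {P Q : Finset (ℕ × FreeGroup α)} (hP : IsDisjointCopies S v P) (h : Q ⊆ P) :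
    IsDisjointCopies S v Q :=
  ⟨fun p hp => hP.1 p (h hp), fun p hp q hq => hP.2 p (h hp) q (h hq)⟩

theorem smallCount_le_add (S : Set (FreeGroup α)) (hw : w.toWord = x.toWord ++ z.toWord) :
    smallCount S w ≤ smallCount S x + smallCount S z + 1 := by
  obtain ⟨P, hP, hPc⟩ := exists_isDisjointCopies S w
  set A := P.filter fun p => p.1 + p.2.norm ≤ x.norm
  set B := P.filter fun p => x.norm ≤ p.1
  set E := P.filter fun p => p.1 < x.norm ∧ x.norm < p.1 + p.2.norm
  have hcover : P ⊆ A ∪ B ∪ E := by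
    intro p hp
    simp only [A, B, E, Finset.mem_union, Finset.mem_filter, hp, true_and]
    omega
  have hA : A.card ≤ smallCount S x := by
    refine IsDisjointCopies.card_le_smallCount (isDisjointCopies_of_separated ?_ ?_)
    · intro p hp
      obtain ⟨hp, hi⟩ := Finset.mem_filter.1 hp
      exact ⟨(hP.1 p hp).1, (hP.1 p hp).2.1, (hP.1 p hp).2.2.of_append_left hw hi⟩
    · exact fun p hp q hq hpq => (hP.subset (Finset.filter_subset _ _)).separated hp hq hpq
  have hB : B.card ≤ smallCount S z := by
    set f : ℕ × FreeGroup α → ℕ × FreeGroup α := fun p => (p.1 - x.norm, p.2)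
    have hf : Set.InjOn f B := by
      rintro ⟨a, b⟩ h1 ⟨c, d⟩ h2 h
      simp only [B, Finset.coe_filter, Set.mem_ofPred_eq] at h1 h2
      simp only [f, Prod.mk.injEq] at h ⊢
      exact ⟨by omega, h.2⟩
    rw [← Finset.card_image_of_injOn hf]
    refine IsDisjointCopies.card_le_smallCount (isDisjointCopies_of_separated ?_ ?_)
    · intro p hp
      obtain ⟨q, hq, rfl⟩ := Finset.mem_image.1 hp
      obtain ⟨hq, hi⟩ := Finset.mem_filter.1 hq
      refine ⟨(hP.1 q hq).1, (hP.1 q hq).2.1, (isCopyAt_add_norm_iff hw).1 ?_⟩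
      simp only [f]
      rw [Nat.add_sub_cancel' hi]
      exact (hP.1 q hq).2.2
    · intro p hp q hq hpq
      obtain ⟨q, hq₀, rfl⟩ := Finset.mem_image.1 hq
      obtain ⟨p, hp₀, rfl⟩ := Finset.mem_image.1 hp
      obtain ⟨hq₁, hi⟩ := Finset.mem_filter.1 hq₀
      obtain ⟨hp₁, hi'⟩ := Finset.mem_filter.1 hp₀
      have := hP.separated hp₁ hq₁ fun h => hpq (h ▸ rfl)
      simp only [f]
      omega
  -- disjoint copies that straddle the junction coincide
  have hE : E.card ≤ 1 := by
    rw [Finset.card_le_one]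
    intro p hp q hq
    by_contra hpq
    obtain ⟨hp, hp'⟩ := Finset.mem_filter.1 hp
    obtain ⟨hq, hq'⟩ := Finset.mem_filter.1 hq
    have := hP.separated hp hq hpq
    omega
  have h1 := Finset.card_le_card hcover
  have h2 := Finset.card_union_le (A ∪ B) E
  have h3 := Finset.card_union_le A B
  omega

/-- Cutting a reduced word in two changes a small counting quasimorphism by at most `1`. -/
theorem abs_smallCountingQM_sub_le (S : Set (FreeGroup α))
    (hw : w.toWord = x.toWord ++ z.toWord) :
    |smallCountingQM S w - smallCountingQM S x - smallCountingQM S z| ≤ 1 := by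
  have h1 : (smallCount S x + smallCount S z : ℝ) ≤ smallCount S w :=
    mod_cast smallCount_add_le S hw
  have h2 : (smallCount S w : ℝ) ≤ smallCount S x + smallCount S z + 1 :=
    mod_cast smallCount_le_add S hw
  have h3 : (smallCount {σ | σ⁻¹ ∈ S} x + smallCount {σ | σ⁻¹ ∈ S} z : ℝ) ≤
      smallCount {σ | σ⁻¹ ∈ S} w := mod_cast smallCount_add_le _ hw
  have h4 : (smallCount {σ | σ⁻¹ ∈ S} w : ℝ) ≤
      smallCount {σ | σ⁻¹ ∈ S} x + smallCount {σ | σ⁻¹ ∈ S} z + 1 :=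
    mod_cast smallCount_le_add _ hw
  simp only [smallCountingQM]
  rw [abs_le]
  constructor <;> linarith

end Append

theorem isCopyAt_inv {σ v : FreeGroup α} {i : ℕ} (h : IsCopyAt σ v i) (hσ : σ ≠ 1) :
    IsCopyAt σ⁻¹ v⁻¹ (v.norm - (i + σ.norm)) := by
  have hle := h.add_norm_le hσ
  obtain ⟨R, hR⟩ := h
  have hlen := congrArg List.length hR
  have hv : v.toWord = v.toWord.take i ++ (σ.toWord ++ R) := by rw [hR, List.take_append_drop]
  rw [IsCopyAt, FreeGroup.toWord_inv, FreeGroup.toWord_inv]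
  rw [hv, FreeGroup.invRev_append, FreeGroup.invRev_append, List.append_assoc]
  have : v.norm - (i + σ.norm) = (FreeGroup.invRev R).length := by
    rw [FreeGroup.invRev_length]
    simp only [List.length_append, List.length_drop, FreeGroup.norm] at *
    omega
  rw [this, List.drop_left]
  exact List.prefix_append _ _

theorem smallCount_inv_le (S : Set (FreeGroup α)) (v : FreeGroup α) :
    smallCount S v ≤ smallCount {σ | σ⁻¹ ∈ S} v⁻¹ := by
  obtain ⟨P, hP, hPc⟩ := exists_isDisjointCopies S v
  set f : ℕ × FreeGroup α → ℕ × FreeGroup α := fun p => (v.norm - (p.1 + p.2.norm), p.2⁻¹)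
  have hle : ∀ p ∈ P, p.1 + p.2.norm ≤ v.norm := fun p hp =>
    (hP.1 p hp).2.2.add_norm_le (hP.1 p hp).2.1
  have hf : Set.InjOn f P := by
    rintro ⟨a, b⟩ h1 ⟨c, d⟩ h2 h
    have h1' := hle _ h1
    have h2' := hle _ h2
    simp only [f, Prod.mk.injEq, inv_inj] at h h1' h2' ⊢
    obtain ⟨h, rfl⟩ := h
    exact ⟨by omega, rfl⟩
  rw [← hPc, ← Finset.card_image_of_injOn hf]
  refine IsDisjointCopies.card_le_smallCount (isDisjointCopies_of_separated ?_ ?_)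
  · intro p hp
    obtain ⟨q, hq, rfl⟩ := Finset.mem_image.1 hp
    obtain ⟨h1, h2, h3⟩ := hP.1 q hq
    exact ⟨by simpa [f] using h1, by simpa [f] using h2, isCopyAt_inv h3 h2⟩
  · intro p hp q hq hpq
    obtain ⟨q, hq₀, rfl⟩ := Finset.mem_image.1 hq
    obtain ⟨p, hp₀, rfl⟩ := Finset.mem_image.1 hp
    have h1 := hP.separated hp₀ hq₀ fun h => hpq (h ▸ rfl)
    have h2 := hle p hp₀
    have h3 := hle q hq₀
    simp only [f, FreeGroup.norm_inv_eq]
    omega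

theorem smallCount_inv (S : Set (FreeGroup α)) (v : FreeGroup α) :
    smallCount {σ | σ⁻¹ ∈ S} v⁻¹ = smallCount S v := by
  refine le_antisymm ?_ (smallCount_inv_le S v)
  simpa using smallCount_inv_le {σ | σ⁻¹ ∈ S} v⁻¹

theorem smallCountingQM_inv (S : Set (FreeGroup α)) (v : FreeGroup α) :
    smallCountingQM S v⁻¹ = -smallCountingQM S v := by
  have h1 := smallCount_inv S v
  have h2 := smallCount_inv S v⁻¹
  rw [inv_inv] at h2
  rw [smallCountingQM, smallCountingQM, h1, ← h2]
  ring

/-- Small counting quasimorphisms have defect at most `3`: one for each edge of the tripod with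
ends `1`, `g`, `g * h`. -/
theorem abs_smallCountingQM_mul_sub_le (S : Set (FreeGroup α)) (g h : FreeGroup α) :
    |smallCountingQM S (g * h) - smallCountingQM S g - smallCountingQM S h| ≤ 3 := by
  obtain ⟨X, Y, Z, hg, hh, hred⟩ := exists_cancellation (FreeGroup.isReduced_toWord (x := g))
    (FreeGroup.isReduced_toWord (x := h))
  have hword : ∀ {L : List (α × Bool)}, FreeGroup.IsReduced L → (FreeGroup.mk L).toWord = L :=
    fun hL => by rw [FreeGroup.toWord_mk, hL.reduce_eq]
  have hX : (FreeGroup.mk X).toWord = X := hword (hred.infix ⟨[], Z, by simp⟩)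
  have hZ : (FreeGroup.mk Z).toWord = Z := hword (hred.infix ⟨X, [], by simp⟩)
  have hY : (FreeGroup.mk Y).toWord = Y :=
    hword ((FreeGroup.isReduced_toWord (x := g)).infix ⟨X, [], by simp [hg]⟩)
  have hgh : (g * h).toWord = X ++ Z := by
    rw [← hword hred, ← FreeGroup.mk_toWord (x := g), ← FreeGroup.mk_toWord (x := h), hg, hh]
    congr 1
    simp only [← FreeGroup.mul_mk, ← FreeGroup.inv_mk]
    group
  have h1 := abs_le.1 (abs_smallCountingQM_sub_le S (w := g * h) (x := .mk X) (z := .mk Z)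
    (by rw [hgh, hX, hZ]))
  have h2 := abs_le.1 (abs_smallCountingQM_sub_le S (w := g) (x := .mk X) (z := .mk Y)
    (by rw [hg, hX, hY]))
  have h3 := abs_le.1 (abs_smallCountingQM_sub_le S (w := h) (x := (.mk Y)⁻¹) (z := .mk Z)
    (by rw [hh, FreeGroup.toWord_inv, hY, hZ]))
  rw [smallCountingQM_inv] at h3
  rw [abs_le]
  constructor <;> linarith [h1.1, h1.2, h2.1, h2.2, h3.1, h3.2]

theorem isQuasimorphism_smallCountingQM (S : Set (FreeGroup α)) :
    IsQuasimorphism (smallCountingQM S) :=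
  ⟨3, abs_smallCountingQM_mul_sub_le S⟩

theorem defect_homogenization_smallCountingQM_le (S : Set (FreeGroup α)) :
    defect (homogenization (smallCountingQM S)) ≤ 6 := by
  have := defect_le (abs_homogenization_mul_sub_le (abs_smallCountingQM_mul_sub_le S)
    (smallCountingQM_inv S))
  linarith

theorem smallCount_inv_uncancelledBlocks (ℓ : ℕ) (v : FreeGroup α) :
    smallCount {σ | σ⁻¹ ∈ uncancelledBlocks ℓ v} v = 0 := by
  obtain ⟨P, hP, hPc⟩ := exists_isDisjointCopies {σ | σ⁻¹ ∈ uncancelledBlocks ℓ v} v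
  rw [← hPc, Finset.card_eq_zero, Finset.eq_empty_iff_forall_notMem]
  intro p hp
  obtain ⟨h1, -, h3⟩ := hP.1 p hp
  refine h1.2 ?_
  rw [inv_inv]
  exact h3.isInfix.trans (List.drop_suffix _ _).isInfix

/-- The indices of the blocks of the word `L` whose inverses occur in `L`. -/
def cancelledIndices (ℓ : ℕ) (L : List (α × Bool)) : Finset ℕ :=
  (Finset.range (L.length / ℓ)).filter fun j => FreeGroup.invRev (blockWord ℓ L j) <:+: L

theorem sub_card_cancelledIndices_le {ℓ : ℕ} (hℓ : 0 < ℓ) (v : FreeGroup α) :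
    v.norm / ℓ - (cancelledIndices ℓ v.toWord).card ≤ smallCount (uncancelledBlocks ℓ v) v := by
  set L := v.toWord with hL
  have hred : FreeGroup.IsReduced L := FreeGroup.isReduced_toWord
  have hword : ∀ j, (FreeGroup.mk (blockWord ℓ L j)).toWord = blockWord ℓ L j := fun j => by
    rw [FreeGroup.toWord_mk, (hred.infix (blockWord_infix ℓ L j)).reduce_eq]
  set T := (Finset.range (L.length / ℓ)) \ cancelledIndices ℓ L with hT
  have hTc : T.card = L.length / ℓ - (cancelledIndices ℓ L).card := by
    have hsub : cancelledIndices ℓ L ⊆ Finset.range (L.length / ℓ) := Finset.filter_subset _ _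
    rw [hT, Finset.card_sdiff_of_subset hsub, Finset.card_range]
  set f : ℕ → ℕ × FreeGroup α := fun j => (j * ℓ, FreeGroup.mk (blockWord ℓ L j)) with hf
  have hinj : Function.Injective f := fun i j h =>
    Nat.eq_of_mul_eq_mul_right hℓ (congrArg Prod.fst h)
  have hnorm : ∀ j ∈ T, (f j).2.norm = ℓ := fun j hj => by
    have := Finset.mem_range.1 (Finset.mem_sdiff.1 hj).1
    rw [FreeGroup.norm, hword, length_blockWord this]
  change L.length / ℓ - _ ≤ _
  rw [← hTc, ← Finset.card_image_of_injective T hinj]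
  refine IsDisjointCopies.card_le_smallCount (isDisjointCopies_of_separated ?_ ?_)
  · intro p hp
    obtain ⟨j, hj, rfl⟩ := Finset.mem_image.1 hp
    obtain ⟨h1, h2⟩ := Finset.mem_sdiff.1 hj
    refine ⟨⟨⟨j, ?_, hword j⟩, fun h => h2 ?_⟩, ?_, ?_⟩
    · exact (Nat.mul_le_mul_right _ (Finset.mem_range.1 h1)).trans (Nat.div_mul_le_self _ _)
    · refine Finset.mem_filter.2 ⟨h1, ?_⟩
      rwa [Appears, FreeGroup.toWord_inv, hword] at h
    · intro h
      have := hnorm j hj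
      rw [h, FreeGroup.norm_one] at this
      omega
    · rw [IsCopyAt, hword]
      exact List.take_prefix _ _
  · intro p hp q hq hpq
    obtain ⟨i, hi, rfl⟩ := Finset.mem_image.1 hp
    obtain ⟨j, hj, rfl⟩ := Finset.mem_image.1 hq
    rw [hnorm i hi, hnorm j hj]
    simp only [f]
    rcases lt_trichotomy i j with h | rfl | h
    · left
      nlinarith
    · exact absurd rfl hpq
    · right
      nlinarith

/-- At `v` the homogenization differs from the counting quasimorphism by at most the defect `3`,
and the counting quasimorphism counts every block whose inverse does not occur in `v`. -/
theorem le_homogenization_smallCountingQM {ℓ : ℕ} (hℓ : 0 < ℓ) (v : FreeGroup α) :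
    ((v.norm / ℓ : ℕ) : ℝ) - (cancelledIndices ℓ v.toWord).card - 3 ≤
      homogenization (smallCountingQM (uncancelledBlocks ℓ v)) v := by
  have h1 := abs_le.1 (abs_homogenization_sub_le
    (abs_smallCountingQM_mul_sub_le (uncancelledBlocks ℓ v)) v)
  have h2 : ((v.norm / ℓ : ℕ) : ℝ) ≤
      smallCount (uncancelledBlocks ℓ v) v + (cancelledIndices ℓ v.toWord).card := by
    exact_mod_cast Nat.sub_le_iff_le_add.1 (sub_card_cancelledIndices_le hℓ v)
  have h3 : smallCountingQM (uncancelledBlocks ℓ v) v = smallCount (uncancelledBlocks ℓ v) v := by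
    rw [smallCountingQM, smallCount_inv_uncancelledBlocks, Nat.cast_zero, sub_zero]
  linarith [h1.1]

end Counting

/-! ### Counting reduced words with repeated inverse blocks -/

section Letters

variable {α : Type*}

/-- The inverse letter. -/
def letterInv (a : α × Bool) : α × Bool := (a.1, !a.2)

theorem letterInv_letterInv (a : α × Bool) : letterInv (letterInv a) = a := by
  simp [letterInv]

theorem letterInv_ne (a : α × Bool) : letterInv a ≠ a := fun h => by
  simpa [letterInv] using congrArg Prod.snd h

theorem isReduced_pair_iff (a b : α × Bool) : (a.1 = b.1 → a.2 = b.2) ↔ a ≠ letterInv b := by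
  obtain ⟨a, s⟩ := a
  obtain ⟨b, t⟩ := b
  cases s <;> cases t <;> simp [letterInv]

theorem invRev_eq (L : List (α × Bool)) : FreeGroup.invRev L = (L.map letterInv).reverse := rfl

theorem isReduced_reverse {L : List (α × Bool)} (h : FreeGroup.IsReduced L) :
    FreeGroup.IsReduced L.reverse := by
  rw [FreeGroup.IsReduced, List.isChain_reverse]
  exact List.IsChain.imp (fun a b hab h' => (hab h'.symm).symm) h

end Letters

section Constrained

variable {α : Type*} [Fintype α]

/-- The reduced words of length `n`. -/
noncomputable def reducedWords (α : Type*) [Fintype α] (n : ℕ) : Finset (List (α × Bool)) :=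
  open Classical in
  ((List.finite_length_eq (α × Bool) n).toFinset).filter FreeGroup.IsReduced

theorem mem_reducedWords {n : ℕ} {L : List (α × Bool)} :
    L ∈ reducedWords α n ↔ L.length = n ∧ FreeGroup.IsReduced L := by
  simp [reducedWords]

/-- The reduced words of length `n` in which, for each `t ∈ D`, the letter in position `t` is
inverse to the letter in position `π t`. -/
noncomputable def constrainedWords (α : Type*) [Fintype α] (D : Finset ℕ) (π : ℕ → ℕ) (n : ℕ) :
    Finset (List (α × Bool)) :=
  open Classical in
  (reducedWords α n).filter fun L => ∀ t ∈ D, t < n → L[t]? = L[π t]?.map letterInv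

theorem mem_constrainedWords {D : Finset ℕ} {π : ℕ → ℕ} {n : ℕ} {L : List (α × Bool)} :
    L ∈ constrainedWords α D π n ↔ (L.length = n ∧ FreeGroup.IsReduced L) ∧
      ∀ t ∈ D, t < n → L[t]? = L[π t]?.map letterInv := by
  simp [constrainedWords, mem_reducedWords]

theorem card_erase_letter (b : α × Bool) [DecidableEq α] :
    (Finset.univ.erase b).card = 2 * Fintype.card α - 1 := by
  rw [Finset.card_erase_of_mem (Finset.mem_univ _), Finset.card_univ, Fintype.card_prod,
    Fintype.card_bool, mul_comm]

/-- A constrained word is extended by one letter in at most `2k - 1` ways, and in at most one way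
if the new position is constrained. -/
theorem card_constrainedWords_succ_le {D : Finset ℕ} {π : ℕ → ℕ} (hπ : ∀ t ∈ D, π t < t)
    {n : ℕ} (hn : n ≠ 0) : (constrainedWords α D π (n + 1)).card ≤
      (if n ∈ D then 1 else 2 * Fintype.card α - 1) * (constrainedWords α D π n).card := by
  classical
  refine Finset.card_le_mul_card_image_of_maps_to (f := List.dropLast) ?_ _ ?_
  · intro L hL
    obtain ⟨⟨hlen, hred⟩, hc⟩ := mem_constrainedWords.1 hL
    refine mem_constrainedWords.2
      ⟨⟨by simp [hlen], hred.infix (List.dropLast_prefix L).isInfix⟩, fun t ht htn => ?_⟩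
    have h1 := hπ t ht
    rw [List.getElem?_dropLast, List.getElem?_dropLast, if_pos (by omega), if_pos (by omega)]
    exact hc t ht (by omega)
  · intro b hb
    obtain ⟨⟨hlen, hred⟩, hc⟩ := mem_constrainedWords.1 hb
    obtain rfl | ⟨b', y, rfl⟩ := List.eq_nil_or_concat' b
    · simp at hlen; omega
    set T : Finset (α × Bool) := if n ∈ D then
      (((b' ++ [y])[π n]?).map letterInv).toFinset else Finset.univ.erase (letterInv y) with hT
    have hTc : T.card ≤ if n ∈ D then 1 else 2 * Fintype.card α - 1 := by
      rw [hT]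
      split_ifs with h
      · cases ((b' ++ [y])[π n]?).map letterInv <;> simp
      · rw [card_erase_letter]
    refine le_trans ?_ hTc
    refine (Finset.card_le_card (t := T.image fun x => (b' ++ [y]) ++ [x]) ?_).trans
      Finset.card_image_le
    intro L hL
    obtain ⟨hL, hLb⟩ := Finset.mem_filter.1 hL
    obtain ⟨⟨hlen', hred'⟩, hc'⟩ := mem_constrainedWords.1 hL
    obtain rfl | ⟨L', x, rfl⟩ := List.eq_nil_or_concat' L
    · simp at hlen'
    rw [List.dropLast_concat] at hLb
    subst hLb
    refine Finset.mem_image.2 ⟨x, ?_, rfl⟩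
    rw [hT]
    split_ifs with h
    · have h1 := hc' n h (by omega)
      have h2 := hπ n h
      rw [List.getElem?_append_right (by omega), List.getElem?_append_left (by omega)] at h1
      rw [hlen, Nat.sub_self] at h1
      rw [← h1]
      simp
    · have h1 : FreeGroup.IsReduced [y, x] := hred'.infix ⟨b', [], by simp⟩
      rw [FreeGroup.isReduced_cons_cons, isReduced_pair_iff] at h1
      refine Finset.mem_erase.2 ⟨fun hx => h1.1 ?_, Finset.mem_univ _⟩
      rw [hx, letterInv_letterInv]

theorem card_constrainedWords_mul_le {D : Finset ℕ} {π : ℕ → ℕ} (hπ : ∀ t ∈ D, π t < t)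
    (n : ℕ) : (constrainedWords α D π (n + 1)).card *
      (2 * Fintype.card α - 1) ^ (D.filter (· < n + 1)).card ≤
      2 * Fintype.card α * (2 * Fintype.card α - 1) ^ n := by
  classical
  induction n with
  | zero =>
    -- position `0` cannot be constrained, since `π 0 < 0` is impossible
    have h1 : D.filter (· < 0 + 1) = ∅ := by
      refine Finset.filter_eq_empty_iff.2 fun t ht h => ?_
      have := hπ t ht
      omega
    rw [h1, Finset.card_empty, pow_zero, mul_one, mul_one]
    refine (Finset.card_le_card (t := Finset.univ.image fun x : α × Bool => [x]) ?_).trans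
      (Finset.card_image_le.trans ?_)
    · intro L hL
      obtain ⟨⟨hlen, -⟩, -⟩ := mem_constrainedWords.1 hL
      obtain ⟨x, rfl⟩ := List.length_eq_one_iff.1 hlen
      simp
    · rw [Finset.card_univ, Fintype.card_prod, Fintype.card_bool, mul_comm]
  | succ n ih =>
    have h1 := card_constrainedWords_succ_le (α := α) hπ (Nat.succ_ne_zero n)
    set q := 2 * Fintype.card α - 1
    set A := (constrainedWords α D π (n + 1)).card
    have hfil : D.filter (· < n + 1 + 1) =
        if n + 1 ∈ D then insert (n + 1) (D.filter (· < n + 1)) else D.filter (· < n + 1) := by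
      split_ifs with h
      · ext t
        simp only [Finset.mem_filter, Finset.mem_insert]
        constructor
        · rintro ⟨h1, h2⟩
          by_cases ht : t = n + 1
          · exact Or.inl ht
          · exact Or.inr ⟨h1, by omega⟩
        · rintro (rfl | ⟨h1, h2⟩)
          · exact ⟨h, by omega⟩
          · exact ⟨h1, by omega⟩
      · ext t
        simp only [Finset.mem_filter]
        refine and_congr_right fun ht => ?_
        have : t ≠ n + 1 := fun h' => h (h' ▸ ht)
        omega
    rw [hfil]
    split_ifs at h1 ⊢ with h
    · rw [Finset.card_insert_of_notMem (by simp), pow_succ, pow_succ, ← mul_assoc, ← mul_assoc]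
      exact Nat.mul_le_mul_right _ ((Nat.mul_le_mul_right _ (by simpa using h1)).trans ih)
    · calc _ ≤ q * A * q ^ (D.filter (· < n + 1)).card := Nat.mul_le_mul_right _ h1
        _ = q * (A * q ^ (D.filter (· < n + 1)).card) := by ring
        _ ≤ q * (2 * Fintype.card α * q ^ n) := Nat.mul_le_mul_left _ ih
        _ = _ := by ring

theorem card_constrainedWords_mul_le_of_lt [Nonempty α] {D : Finset ℕ} {π : ℕ → ℕ} {n : ℕ}
    (hn : n ≠ 0) (hD : ∀ t ∈ D, t < n) (hπ : ∀ t ∈ D, π t < t) :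
    (constrainedWords α D π n).card * (2 * Fintype.card α - 1) ^ D.card ≤
      2 * Fintype.card α * (2 * Fintype.card α - 1) ^ n := by
  obtain ⟨m, rfl⟩ := Nat.exists_eq_succ_of_ne_zero hn
  have h := card_constrainedWords_mul_le (α := α) hπ m
  rw [Finset.filter_true_of_mem hD] at h
  refine h.trans (Nat.mul_le_mul_left _ (Nat.pow_le_pow_right ?_ (Nat.le_succ m)))
  have := Fintype.card_pos (α := α)
  omega

/-- The same bound for constraints that refer to later letters, by reading words backwards. -/
theorem card_constrainedWords_mul_le_of_gt [Nonempty α] {D : Finset ℕ} {π : ℕ → ℕ} {n : ℕ}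
    (hn : n ≠ 0) (hπ : ∀ t ∈ D, t < π t ∧ π t < n) :
    (constrainedWords α D π n).card * (2 * Fintype.card α - 1) ^ D.card ≤
      2 * Fintype.card α * (2 * Fintype.card α - 1) ^ n := by
  classical
  have hD : ∀ t ∈ D, t < n := fun t ht => (hπ t ht).1.trans (hπ t ht).2
  set D' := D.image (fun t => n - 1 - t)
  set π' : ℕ → ℕ := fun t => n - 1 - π (n - 1 - t)
  have hcard : D'.card = D.card := by
    refine Finset.card_image_of_injOn fun s hs t ht hst => ?_
    have h1 := hD s hs
    have h2 := hD t ht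
    omega
  have hD' : ∀ t' ∈ D', n - 1 - t' ∈ D ∧ t' < n := by
    intro t' ht'
    obtain ⟨t, ht, rfl⟩ := Finset.mem_image.1 ht'
    have := hD t ht
    rw [show n - 1 - (n - 1 - t) = t by omega]
    exact ⟨ht, by omega⟩
  have hπ' : ∀ t ∈ D', π' t < t := by
    intro t' ht'
    obtain ⟨t, ht, rfl⟩ := Finset.mem_image.1 ht'
    have h1 := hπ t ht
    simp only [π']
    rw [show n - 1 - (n - 1 - t) = t by omega]
    omega
  have h := card_constrainedWords_mul_le_of_lt (α := α) hn (fun t ht => (hD' t ht).2) hπ'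
  rw [hcard] at h
  refine (Nat.mul_le_mul_right _ ?_).trans h
  refine Finset.card_le_card_of_injOn List.reverse ?_ List.reverse_injective.injOn
  intro L hL
  obtain ⟨⟨hlen, hred⟩, hc⟩ := mem_constrainedWords.1 hL
  refine mem_constrainedWords.2 ⟨⟨by simp [hlen], isReduced_reverse hred⟩, fun t' ht' htn => ?_⟩
  have h1 := hc _ (hD' t' ht').1 (hD _ (hD' t' ht').1)
  have h2 := hπ _ (hD' t' ht').1
  rw [List.getElem?_reverse (by omega), List.getElem?_reverse (by simp only [π']; omega), hlen, h1]
  simp only [π']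
  congr 2
  omega

end Constrained

section Matching

variable {α : Type*}

/-- The `j`-th block of length `ℓ` of `L` is inverse to the subword that starts after `i`
letters. -/
def BlockMatches (ℓ : ℕ) (L : List (α × Bool)) (j i : ℕ) : Prop :=
  ∀ s < ℓ, L[j * ℓ + s]? = L[i + (ℓ - 1 - s)]?.map letterInv

theorem exists_blockMatches {ℓ j : ℕ} {L : List (α × Bool)} (hj : j < L.length / ℓ)
    (h : FreeGroup.invRev (blockWord ℓ L j) <:+: L) :
    ∃ i, i + ℓ ≤ L.length ∧ BlockMatches ℓ L j i := by
  have hlen := length_blockWord hj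
  set b := blockWord ℓ L j with hb
  obtain ⟨A, B, hAB⟩ := h
  refine ⟨A.length, ?_, fun s hs => ?_⟩
  · rw [← hAB]
    simp only [List.length_append, FreeGroup.invRev_length, hlen]
    omega
  · have h1 : L[A.length + (ℓ - 1 - s)]? = b[s]?.map letterInv := by
      rw [← hAB, List.append_assoc, List.getElem?_append_right (by omega),
        List.getElem?_append_left (by simp only [FreeGroup.invRev_length]; omega), invRev_eq,
        List.getElem?_reverse (by rw [List.length_map]; omega), List.getElem?_map,
        List.length_map]
      congr 2
      omega
    have h2 : b[s]? = L[j * ℓ + s]? := by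
      rw [hb, blockWord, List.getElem?_take_of_lt hs, List.getElem?_drop]
    rw [h1, h2]
    cases L[j * ℓ + s]? <;> simp [letterInv_letterInv]

/-- A subword of a reduced word does not overlap an occurrence of its inverse: in the middle of
the overlap two equal or adjacent letters would be inverse to each other. -/
theorem BlockMatches.disjoint {ℓ j i : ℕ} {L : List (α × Bool)} (hred : FreeGroup.IsReduced L)
    (hj : j < L.length / ℓ) (hi : i + ℓ ≤ L.length) (h : BlockMatches ℓ L j i) :
    i + ℓ ≤ j * ℓ ∨ j * ℓ + ℓ ≤ i := by
  have hjl : j * ℓ + ℓ ≤ L.length := by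
    have := (Nat.mul_le_mul_right ℓ hj).trans (Nat.div_mul_le_self _ _)
    rwa [Nat.succ_mul] at this
  by_contra! hc
  obtain ⟨h1, h2⟩ := hc
  -- the match pairs the positions whose sum is `j * ℓ + i + ℓ - 1`; `t` is in the middle
  set t := (j * ℓ + i + ℓ - 1) / 2 with ht
  have hm := h (t - j * ℓ) (by omega)
  rw [show j * ℓ + (t - j * ℓ) = t by omega,
    List.getElem?_eq_getElem (by omega), List.getElem?_eq_getElem (by omega), Option.map_some,
    Option.some_inj] at hm
  rcases Nat.even_or_odd' (j * ℓ + i + ℓ - 1) with ⟨c, hc | hc⟩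
  · have e : i + (ℓ - 1 - (t - j * ℓ)) = t := by omega
    simp only [e] at hm
    exact letterInv_ne _ hm.symm
  · have e : i + (ℓ - 1 - (t - j * ℓ)) = t + 1 := by omega
    simp only [e] at hm
    have := List.isChain_iff_getElem.1 hred t (by omega)
    exact (isReduced_pair_iff _ _).1 this hm

/-- The indices of those of the first `n / ℓ` blocks of `L` that are matched with a position
related to them by `R`. -/
noncomputable def matchedIndices (R : ℕ → ℕ → Prop) (ℓ n : ℕ) (L : List (α × Bool)) : Finset ℕ :=
  open Classical in
  (Finset.range (n / ℓ)).filter fun j => ∃ i < n, R j i ∧ BlockMatches ℓ L j i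

theorem mem_matchedIndices {R : ℕ → ℕ → Prop} {ℓ n j : ℕ} {L : List (α × Bool)} :
    j ∈ matchedIndices R ℓ n L ↔
      j ∈ Finset.range (n / ℓ) ∧ ∃ i < n, R j i ∧ BlockMatches ℓ L j i := by
  simp [matchedIndices]

end Matching

section UnionBound

variable {α : Type*} [Fintype α]

/-- The reduced words of length `n` in which at least `r` blocks are matched with a position
related to them by `R`. -/
noncomputable def matchedWords (α : Type*) [Fintype α] (R : ℕ → ℕ → Prop) (ℓ n r : ℕ) :
    Finset (List (α × Bool)) :=
  open Classical in
  (reducedWords α n).filter fun L => r ≤ (matchedIndices R ℓ n L).card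

theorem card_matchedWords_mul_le [Nonempty α] {R : ℕ → ℕ → Prop} {ℓ n r : ℕ} (hℓ : 0 < ℓ)
    (hn : n ≠ 0)
    (hR : (∀ j i, R j i → i + ℓ ≤ j * ℓ) ∨ ∀ j i, R j i → j * ℓ + ℓ ≤ i ∧ i + ℓ ≤ n) :
    (matchedWords α R ℓ n r).card * (2 * Fintype.card α - 1) ^ (r * ℓ) ≤
      2 ^ (n / ℓ) * n ^ r * (2 * Fintype.card α * (2 * Fintype.card α - 1) ^ n) := by
  classical
  set q := 2 * Fintype.card α - 1
  set K := 2 * Fintype.card α * q ^ n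
  -- the words in which the block `j ∈ J` is matched with the position `w j`
  let A : (J : Finset ℕ) → ((j : ℕ) → j ∈ J → ℕ) → Finset (List (α × Bool)) := fun J w =>
    (reducedWords α n).filter fun L =>
      ∀ j, ∀ hj : j ∈ J, R j (w j hj) ∧ BlockMatches ℓ L j (w j hj)
  have hA : ∀ J ∈ (Finset.range (n / ℓ)).powersetCard r, ∀ w : (j : ℕ) → j ∈ J → ℕ,
      (A J w).card * q ^ (r * ℓ) ≤ K := by
    intro J hJ w
    obtain ⟨hJM, hJr⟩ := Finset.mem_powersetCard.1 hJ
    by_cases hRw : ∀ j, ∀ hj : j ∈ J, R j (w j hj)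
    swap
    · have : A J w = ∅ := Finset.filter_eq_empty_iff.2 fun L _ h =>
        hRw fun j hj => (h j hj).1
      rw [this, Finset.card_empty, zero_mul]
      exact Nat.zero_le _
    set D := (Finset.range n).filter fun t => t / ℓ ∈ J with hDdef
    set π : ℕ → ℕ := fun t =>
      if h : t / ℓ ∈ J then w (t / ℓ) h + (ℓ - 1 - t % ℓ) else 0 with hπ
    have hDcard : r * ℓ ≤ D.card := by
      have : r * ℓ = (J ×ˢ Finset.range ℓ).card := by
        rw [Finset.card_product, Finset.card_range, hJr]
      rw [this]
      refine Finset.card_le_card_of_injOn (fun p => p.1 * ℓ + p.2) ?_ ?_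
      · rintro ⟨j, s⟩ hp
        obtain ⟨hj, hs⟩ := Finset.mem_product.1 (Finset.mem_coe.1 hp)
        simp only [Finset.mem_range] at hj hs
        have h1 : (j * ℓ + s) / ℓ = j := by
          rw [mul_comm, Nat.mul_add_div hℓ, Nat.div_eq_of_lt hs, add_zero]
        have h2 := (Nat.mul_le_mul_right ℓ (Finset.mem_range.1 (hJM hj))).trans
          (Nat.div_mul_le_self n ℓ)
        rw [Nat.succ_mul] at h2
        refine Finset.mem_coe.2 (Finset.mem_filter.2 ⟨Finset.mem_range.2 ?_, ?_⟩)
        · simp only; omega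
        · simpa only [h1] using hj
      · rintro ⟨j, s⟩ hp ⟨j', s'⟩ hp' h
        have hs := Finset.mem_range.1 (Finset.mem_product.1 (Finset.mem_coe.1 hp)).2
        have hs' := Finset.mem_range.1 (Finset.mem_product.1 (Finset.mem_coe.1 hp')).2
        simp only at h hs hs'
        have e1 : (j * ℓ + s) / ℓ = j := by
          rw [mul_comm, Nat.mul_add_div hℓ, Nat.div_eq_of_lt hs, add_zero]
        have e2 : (j' * ℓ + s') / ℓ = j' := by
          rw [mul_comm, Nat.mul_add_div hℓ, Nat.div_eq_of_lt hs', add_zero]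
        have : j = j' := by rw [← e1, ← e2, h]
        subst this
        exact Prod.ext rfl (by simpa using h)
    have hsub : A J w ⊆ constrainedWords α D π n := by
      intro L hL
      obtain ⟨hL, hm⟩ := Finset.mem_filter.1 hL
      refine mem_constrainedWords.2 ⟨mem_reducedWords.1 hL, fun t ht _ => ?_⟩
      have htJ := (Finset.mem_filter.1 ht).2
      have := (hm _ htJ).2 (t % ℓ) (Nat.mod_lt _ hℓ)
      rw [Nat.div_add_mod'] at this
      rw [this]
      simp only [hπ, dif_pos htJ]
    have hbound : (constrainedWords α D π n).card * q ^ D.card ≤ K := by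
      rcases hR with hR | hR
      · refine card_constrainedWords_mul_le_of_lt hn
          (fun t ht => Finset.mem_range.1 (Finset.mem_filter.1 ht).1) fun t ht => ?_
        have htJ := (Finset.mem_filter.1 ht).2
        have h1 := hR _ _ (hRw _ htJ)
        have h2 := Nat.div_mul_le_self t ℓ
        simp only [hπ, dif_pos htJ]
        omega
      · refine card_constrainedWords_mul_le_of_gt hn fun t ht => ?_
        have htJ := (Finset.mem_filter.1 ht).2
        have h1 := hR _ _ (hRw _ htJ)
        have h2 := Nat.div_add_mod' t ℓ
        have h3 := Nat.mod_lt t hℓ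
        simp only [hπ, dif_pos htJ]
        omega
    have hq : 0 < q := by
      have := Fintype.card_pos (α := α)
      omega
    exact (Nat.mul_le_mul (Finset.card_le_card hsub) (Nat.pow_le_pow_right hq hDcard)).trans hbound
  have hcover : matchedWords α R ℓ n r ⊆
      ((Finset.range (n / ℓ)).powersetCard r).biUnion fun J =>
        (J.pi fun _ => Finset.range n).biUnion fun w => A J w := by
    intro L hL
    obtain ⟨hL, hr⟩ := Finset.mem_filter.1 hL
    obtain ⟨J, hJ, hJr⟩ := Finset.exists_subset_card_eq hr
    have hex : ∀ j ∈ J, ∃ i < n, R j i ∧ BlockMatches ℓ L j i := fun j hj =>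
      (mem_matchedIndices.1 (hJ hj)).2
    choose w hw using hex
    simp only [Finset.mem_biUnion]
    refine ⟨J, Finset.mem_powersetCard.2
      ⟨fun j hj => (mem_matchedIndices.1 (hJ hj)).1, hJr⟩, w,
      Finset.mem_pi.2 fun j hj => Finset.mem_range.2 (hw j hj).1,
      Finset.mem_filter.2 ⟨hL, fun j hj => (hw j hj).2⟩⟩
  calc (matchedWords α R ℓ n r).card * q ^ (r * ℓ)
      ≤ (∑ J ∈ (Finset.range (n / ℓ)).powersetCard r,
          ∑ w ∈ J.pi fun _ => Finset.range n, (A J w).card) * q ^ (r * ℓ) := by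
        refine Nat.mul_le_mul_right _ ((Finset.card_le_card hcover).trans
          (Finset.card_biUnion_le.trans (Finset.sum_le_sum fun J _ => Finset.card_biUnion_le)))
    _ = ∑ J ∈ (Finset.range (n / ℓ)).powersetCard r,
          ∑ w ∈ J.pi fun _ => Finset.range n, (A J w).card * q ^ (r * ℓ) := by
        simp only [Finset.sum_mul]
    _ ≤ ∑ J ∈ (Finset.range (n / ℓ)).powersetCard r,
          ∑ w ∈ J.pi fun _ => Finset.range n, K :=
        Finset.sum_le_sum fun J hJ => Finset.sum_le_sum fun w _ => hA J hJ w
    _ = ∑ J ∈ (Finset.range (n / ℓ)).powersetCard r, n ^ r * K := by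
        refine Finset.sum_congr rfl fun J hJ => ?_
        rw [Finset.sum_const, Finset.card_pi, Finset.prod_const, Finset.card_range,
          (Finset.mem_powersetCard.1 hJ).2, smul_eq_mul]
    _ ≤ 2 ^ (n / ℓ) * (n ^ r * K) := by
        rw [Finset.sum_const, Finset.card_powersetCard, Finset.card_range, smul_eq_mul]
        exact Nat.mul_le_mul_right _ (Nat.choose_le_two_pow _ _)
    _ = _ := by ring

/-- Few reduced words have many blocks whose inverses occur: each such block is determined by the
letters before it, or by the letters after it. -/
theorem card_filter_cancelledIndices_mul_le [Nonempty α] [DecidableEq α] {ℓ n r : ℕ}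
    (hℓ : 0 < ℓ) (hn : n ≠ 0) :
    ((reducedWords α n).filter fun L => 2 * r ≤ (cancelledIndices ℓ L).card).card *
        (2 * Fintype.card α - 1) ^ (r * ℓ) ≤
      2 * (2 ^ (n / ℓ) * n ^ r * (2 * Fintype.card α * (2 * Fintype.card α - 1) ^ n)) := by
  classical
  set R₁ : ℕ → ℕ → Prop := fun j i => i + ℓ ≤ j * ℓ
  set R₂ : ℕ → ℕ → Prop := fun j i => j * ℓ + ℓ ≤ i ∧ i + ℓ ≤ n
  have h1 := card_matchedWords_mul_le (α := α) (R := R₁) (r := r) hℓ hn (Or.inl fun _ _ h => h)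
  have h2 := card_matchedWords_mul_le (α := α) (R := R₂) (r := r) hℓ hn (Or.inr fun _ _ h => h)
  have hsub : ((reducedWords α n).filter fun L => 2 * r ≤ (cancelledIndices ℓ L).card) ⊆
      matchedWords α R₁ ℓ n r ∪ matchedWords α R₂ ℓ n r := by
    intro L hL
    obtain ⟨hL, hr⟩ := Finset.mem_filter.1 hL
    obtain ⟨hlen, hred⟩ := mem_reducedWords.1 hL
    have hc : cancelledIndices ℓ L ⊆
        matchedIndices R₁ ℓ n L ∪ matchedIndices R₂ ℓ n L := by
      intro j hj
      obtain ⟨hj, hinf⟩ := Finset.mem_filter.1 hj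
      have hj' := Finset.mem_range.1 hj
      obtain ⟨i, hi, hm⟩ := exists_blockMatches hj' hinf
      rw [hlen] at hi hj
      refine Finset.mem_union.2 ?_
      rcases hm.disjoint hred hj' (by omega) with h | h
      · exact Or.inl (mem_matchedIndices.2 ⟨hj, i, by omega, h, hm⟩)
      · exact Or.inr (mem_matchedIndices.2 ⟨hj, i, by omega, ⟨h, hi⟩, hm⟩)
    have hcc := (Finset.card_le_card hc).trans (Finset.card_union_le _ _)
    refine Finset.mem_union.2 ?_
    by_contra! hno
    have g1 : ¬ r ≤ (matchedIndices R₁ ℓ n L).card := fun h =>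
      hno.1 (Finset.mem_filter.2 ⟨hL, h⟩)
    have g2 : ¬ r ≤ (matchedIndices R₂ ℓ n L).card := fun h =>
      hno.2 (Finset.mem_filter.2 ⟨hL, h⟩)
    omega
  refine (Nat.mul_le_mul_right _ ((Finset.card_le_card hsub).trans
    (Finset.card_union_le _ _))).trans ?_
  rw [add_mul]
  exact (add_le_add h1 h2).trans (two_mul _).symm.le

end UnionBound

/-! ### The number of words in the commutator subgroup -/

section CommutatorSphere

variable {α : Type*}

theorem abelianization_mk_eq_of_perm {L₁ L₂ : List (α × Bool)} (h : L₁.Perm L₂) :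
    Abelianization.of (FreeGroup.mk L₁) = Abelianization.of (FreeGroup.mk L₂) := by
  have key : ∀ L : List (α × Bool), Abelianization.of (FreeGroup.mk L) =
      (L.map fun a => Abelianization.of (FreeGroup.mk [a])).prod := by
    intro L
    induction L with
    | nil => rw [List.map_nil, List.prod_nil, ← FreeGroup.one_eq_mk, map_one]
    | cons a L ih =>
      rw [List.map_cons, List.prod_cons, ← ih, ← map_mul, FreeGroup.mul_mk, List.singleton_append]
  rw [key, key]
  exact (h.map _).prod_eq

theorem mem_commutator_iff {G : Type*} [Group G] (g : G) :
    g ∈ commutator G ↔ Abelianization.of g = 1 := by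
  rw [← MonoidHom.mem_ker, Abelianization.ker_of]

/-- A word in the commutator subgroup that keeps `L₁` and `L₂⁻¹` apart, where both `L₁` and `L₂`
end in the generator `x`. -/
def bridge (x y : α) : List (α × Bool) := [(y, true), (x, true), (y, false), (x, false)]

theorem mk_bridged_mem_commutator (x y : α) {L₁ L₂ : List (α × Bool)} (h : L₁.Perm L₂) :
    FreeGroup.mk (L₁ ++ bridge x y ++ FreeGroup.invRev L₂) ∈ commutator (FreeGroup α) := by
  have hb : FreeGroup.mk (bridge x y) = FreeGroup.of y * FreeGroup.of x * (FreeGroup.of y)⁻¹ *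
      (FreeGroup.of x)⁻¹ := rfl
  have hb' : Abelianization.of (FreeGroup.of y * FreeGroup.of x * (FreeGroup.of y)⁻¹ *
      (FreeGroup.of x)⁻¹) = 1 := by
    rw [map_mul, map_mul, map_mul, map_inv, map_inv, mul_inv_cancel_comm, mul_inv_cancel]
  rw [mem_commutator_iff, ← FreeGroup.mul_mk, ← FreeGroup.mul_mk, ← FreeGroup.inv_mk, map_mul,
    map_mul, map_inv, abelianization_mk_eq_of_perm h, hb, hb', mul_one, mul_inv_cancel]

theorem isReduced_bridged {x y : α} (hxy : x ≠ y) {L₁ L₂ : List (α × Bool)}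
    (h₁ : FreeGroup.IsReduced (L₁ ++ [(x, true)])) (h₂ : FreeGroup.IsReduced (L₂ ++ [(x, true)])) :
    FreeGroup.IsReduced ((L₁ ++ [(x, true)]) ++ bridge x y ++
      FreeGroup.invRev (L₂ ++ [(x, true)])) := by
  have hb : FreeGroup.IsReduced ([(x, true)] ++ (bridge x y ++ [(x, false)])) := by
    simp [bridge, hxy, hxy.symm]
  have h3 := h₁.append_overlap hb (by simp)
  have h4 := isReduced_invRev h₂
  rw [FreeGroup.invRev_append, show FreeGroup.invRev [(x, true)] = [(x, false)] from rfl] at h4 ⊢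
  rw [← List.append_assoc] at h3
  have h5 := h3.append_overlap h4 (by simp)
  simpa using h5

variable [Fintype α]

/-- The reduced words of length `n` that end in the letter `a`. -/
noncomputable def reducedWordsEndingIn (a : α × Bool) (n : ℕ) : Finset (List (α × Bool)) :=
  open Classical in
  (reducedWords α n).filter fun L => ∃ L', L = L' ++ [a]

theorem mem_reducedWordsEndingIn {a : α × Bool} {n : ℕ} {L : List (α × Bool)} :
    L ∈ reducedWordsEndingIn a n ↔
      (L.length = n ∧ FreeGroup.IsReduced L) ∧ ∃ L', L = L' ++ [a] := by
  simp [reducedWordsEndingIn, mem_reducedWords]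

theorem pow_le_card_reducedWordsEndingIn (a : α × Bool) (m : ℕ) :
    (2 * Fintype.card α - 1) ^ m ≤ (reducedWordsEndingIn a (m + 1)).card := by
  classical
  induction m with
  | zero =>
    rw [pow_zero, Nat.one_le_iff_ne_zero, ← Nat.pos_iff_ne_zero, Finset.card_pos]
    exact ⟨[a], mem_reducedWordsEndingIn.2 ⟨⟨rfl, FreeGroup.IsReduced.singleton⟩, [], rfl⟩⟩
  | succ m ih =>
    -- the letters that can be put in front of a nonempty word `L`; the default of `headD` is unused
    set T : List (α × Bool) → Finset (α × Bool) := fun L =>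
      Finset.univ.erase (letterInv (L.headD a))
    have hT : ((reducedWordsEndingIn a (m + 1)).sigma T).card =
        (reducedWordsEndingIn a (m + 1)).card * (2 * Fintype.card α - 1) := by
      rw [Finset.card_sigma, Finset.sum_congr rfl fun L _ => card_erase_letter _,
        Finset.sum_const, smul_eq_mul]
    refine (Nat.mul_le_mul_right _ ih).trans (hT.symm.le.trans ?_)
    refine Finset.card_le_card_of_injOn (fun p => p.2 :: p.1) ?_ ?_
    · rintro ⟨L, b⟩ hp
      obtain ⟨hL, hb⟩ := Finset.mem_sigma.1 (Finset.mem_coe.1 hp)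
      obtain ⟨⟨hlen, hred⟩, L', rfl⟩ := mem_reducedWordsEndingIn.1 hL
      refine Finset.mem_coe.2 (mem_reducedWordsEndingIn.2 ⟨⟨by simpa using hlen, ?_⟩, b :: L', rfl⟩)
      obtain ⟨c, M, hc⟩ := List.exists_cons_of_ne_nil (l := L' ++ [a]) (by simp)
      simp only [T, hc, List.headD_cons, Finset.mem_erase] at hb
      simp only [hc] at hred ⊢
      exact FreeGroup.isReduced_cons_cons.2 ⟨(isReduced_pair_iff _ _).2 hb.1, hred⟩
    · rintro ⟨L, b⟩ _ ⟨L', b'⟩ _ h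
      simp only [List.cons.injEq] at h
      obtain ⟨rfl, rfl⟩ := h
      rfl

/-- By the pigeonhole principle many reduced words with a given last letter are permutations of
each other. -/
theorem exists_large_perm_class (a : α × Bool) (m : ℕ) :
    ∃ A ⊆ reducedWordsEndingIn a (m + 1), (∀ L ∈ A, ∀ L' ∈ A, L.Perm L') ∧
      (2 * Fintype.card α - 1) ^ m ≤ A.card * (m + 2) ^ (2 * Fintype.card α) := by
  classical
  set W := reducedWordsEndingIn a (m + 1)
  set f : List (α × Bool) → (α × Bool → ℕ) := fun L b => L.count b
  set t : Finset (α × Bool → ℕ) := Fintype.piFinset fun _ => Finset.range (m + 2)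
  have hmaps : ∀ L ∈ W, f L ∈ t := by
    intro L hL
    have hlen := (mem_reducedWordsEndingIn.1 hL).1.1
    refine Fintype.mem_piFinset.2 fun b => Finset.mem_range.2 ?_
    have := List.count_le_length (a := b) (l := L)
    simp only [f]
    omega
  have htc : t.card = (m + 2) ^ (2 * Fintype.card α) := by
    rw [Fintype.card_piFinset, Finset.prod_const, Finset.card_range, Finset.card_univ,
      Fintype.card_prod, Fintype.card_bool, mul_comm]
  have htne : t.Nonempty := by
    rw [← Finset.card_pos, htc]
    positivity
  obtain ⟨y, -, hy⟩ := Finset.exists_max_image t (fun y => (W.filter fun L => f L = y).card) htne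
  refine ⟨W.filter fun L => f L = y, Finset.filter_subset _ _, ?_, ?_⟩
  · intro L hL L' hL'
    have h1 := (Finset.mem_filter.1 hL).2
    have h2 := (Finset.mem_filter.1 hL').2
    refine List.perm_iff_count.2 fun b => ?_
    exact congrFun (h1.trans h2.symm) b
  · rw [← htc]
    exact (pow_le_card_reducedWordsEndingIn a m).trans
      (Finset.card_le_mul_card_image_of_maps_to hmaps _ hy)

/-- The commutator subgroup contains at least a polynomial fraction of all reduced words of even
length: pairs `L₁, L₂` of permuted words give elements `L₁ [y, x] L₂⁻¹`. -/
theorem pow_le_ncard_commutatorSphere {k : ℕ} (hk : 2 ≤ k) (m : ℕ) :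
    (2 * k - 1) ^ (2 * m) ≤ (commutatorSphere k (2 * m + 6)).ncard * (m + 2) ^ (4 * k) := by
  classical
  let x : Fin k := ⟨0, by omega⟩
  let y : Fin k := ⟨1, by omega⟩
  have hxy : x ≠ y := by simp [x, y, Fin.ext_iff]
  obtain ⟨A, hAW, hperm, hcard⟩ := exists_large_perm_class (x, true) m
  rw [Fintype.card_fin] at hcard
  have hA : ∀ L ∈ A, (L.length = m + 1 ∧ FreeGroup.IsReduced L) ∧ ∃ L', L = L' ++ [(x, true)] :=
    fun L hL => mem_reducedWordsEndingIn.1 (hAW hL)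
  set g : List (Fin k × Bool) × List (Fin k × Bool) → FreeGroup (Fin k) := fun p =>
    FreeGroup.mk (p.1 ++ bridge x y ++ FreeGroup.invRev p.2) with hg
  have hword : ∀ p ∈ A ×ˢ A, (g p).toWord = p.1 ++ bridge x y ++ FreeGroup.invRev p.2 := by
    rintro ⟨L₁, L₂⟩ hp
    obtain ⟨h1, h2⟩ := Finset.mem_product.1 hp
    obtain ⟨⟨-, hr1⟩, L₁, rfl⟩ := hA _ h1
    obtain ⟨⟨-, hr2⟩, L₂, rfl⟩ := hA _ h2
    rw [hg, FreeGroup.toWord_mk, (isReduced_bridged hxy hr1 hr2).reduce_eq]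
  have hsq : A.card * A.card ≤ (commutatorSphere k (2 * m + 6)).ncard := by
    rw [← Finset.card_product, ← Set.ncard_coe_finset]
    refine Set.ncard_le_ncard_of_injOn g ?_ ?_ (finite_commutatorSphere k _)
    · rintro ⟨L₁, L₂⟩ hp
      obtain ⟨h1, h2⟩ := Finset.mem_product.1 (Finset.mem_coe.1 hp)
      refine ⟨?_, mk_bridged_mem_commutator x y (hperm _ h1 _ h2)⟩
      rw [FreeGroup.norm, hword _ (Finset.mem_coe.1 hp)]
      simp only [List.length_append, FreeGroup.invRev_length, (hA _ h1).1.1, (hA _ h2).1.1, bridge,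
        List.length_cons, List.length_nil]
      omega
    · rintro ⟨L₁, L₂⟩ hp ⟨M₁, M₂⟩ hq h
      have h' := congrArg FreeGroup.toWord h
      rw [hword _ (Finset.mem_coe.1 hp), hword _ (Finset.mem_coe.1 hq)] at h'
      obtain ⟨h1, h2⟩ := Finset.mem_product.1 (Finset.mem_coe.1 hp)
      obtain ⟨h3, h4⟩ := Finset.mem_product.1 (Finset.mem_coe.1 hq)
      have hl : L₁.length = M₁.length := (hA _ h1).1.1.trans (hA _ h3).1.1.symm
      simp only [List.append_assoc] at h'
      obtain ⟨e1, e2⟩ := List.append_inj h' hl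
      rw [List.append_cancel_left_eq] at e2
      exact Prod.ext e1 (FreeGroup.invRev_injective e2)
  calc (2 * k - 1) ^ (2 * m) = (2 * k - 1) ^ m * (2 * k - 1) ^ m := by rw [two_mul m, pow_add]
    _ ≤ (A.card * (m + 2) ^ (2 * k)) * (A.card * (m + 2) ^ (2 * k)) := Nat.mul_le_mul hcard hcard
    _ = A.card * A.card * (m + 2) ^ (4 * k) := by
        rw [show 4 * k = 2 * k + 2 * k by ring, pow_add]; ring
    _ ≤ _ := Nat.mul_le_mul_right _ hsq

end CommutatorSphere

/-! ### Asymptotics -/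

section Asymptotics

variable {k n : ℕ} {ε : ℝ}

theorem three_le_two_mul_sub_one (hk : 2 ≤ k) : (3 : ℝ) ≤ 2 * k - 1 := by
  have : (2 : ℝ) ≤ k := by exact_mod_cast hk
  linarith

theorem log_two_mul_sub_one_pos (hk : 2 ≤ k) : 0 < Real.log (2 * k - 1) :=
  Real.log_pos (by linarith [three_le_two_mul_sub_one hk])

theorem rpow_le_pow_blockLength (hk : 2 ≤ k) (hn : 2 ≤ n) :
    (n : ℝ) ^ (1 + ε / 2) ≤ (2 * k - 1 : ℝ) ^ blockLength k ε n := by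
  have hq := three_le_two_mul_sub_one hk
  have hl := log_two_mul_sub_one_pos hk
  have hnr : (0 : ℝ) < n := by positivity
  have h1 : (1 + ε / 2) * (Real.log n / Real.log (2 * k - 1)) ≤ blockLength k ε n :=
    Nat.le_ceil _
  rw [← mul_div_assoc, div_le_iff₀ hl] at h1
  rw [← Real.log_le_log_iff (by positivity) (by positivity), Real.log_rpow hnr, Real.log_pow]
  exact h1

theorem blockLength_pos (hk : 2 ≤ k) (hε : 0 < ε) (hn : 2 ≤ n) : 0 < blockLength k ε n := by
  have hl := log_two_mul_sub_one_pos hk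
  have : 0 < Real.log n := Real.log_pos (by exact_mod_cast hn)
  exact Nat.ceil_pos.2 (by positivity)

/-- If the inverses of fewer than `2r` blocks of `v` occur in `v`, where `r` is a small proportion
of the number of blocks, then `v` has large value under its certifying quasimorphism. The constant
`1 + 3ε / 4` lies between the factor `1 + ε / 2` of the block length, leaving room for rounding up,
and the factor `1 + ε` of the bound; half of the gap `δ` pays for the cancelled blocks, the other
half for additive constants. -/
theorem le_certifyingQM (hk : 2 ≤ k) (hε : 0 < ε) (hn : 2 ≤ n) {δ : ℝ}
    (hδ : δ = 1 / (1 + 3 * ε / 4) - 1 / (1 + ε))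
    (h1 : 4 * Real.log (2 * k - 1) / ε ≤ Real.log n)
    (h2 : 12 * Real.log n ≤ δ * (n * Real.log (2 * k - 1)))
    {v : FreeGroup (Fin k)} (hv : v.norm = n)
    (hc : (cancelledIndices (blockLength k ε n) v.toWord).card <
      2 * ⌈δ / 4 * (n * Real.log (2 * k - 1) / Real.log n)⌉₊) :
    1 / (1 + ε) * (n * Real.log (2 * k - 1) / Real.log n) ≤ certifyingQM ε v v := by
  have hl := log_two_mul_sub_one_pos hk
  have hlog : 0 < Real.log n := Real.log_pos (by exact_mod_cast hn)
  have hnr : (0 : ℝ) < n := by positivity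
  set l := Real.log (2 * k - 1)
  set T := n * l / Real.log n with hT
  set ℓ := blockLength k ε n with hℓ
  have hℓ0 : 0 < ℓ := blockLength_pos hk hε hn
  have hℓr : (0 : ℝ) < ℓ := by exact_mod_cast hℓ0
  have hTpos : 0 < T := by positivity
  have hδ0 : 0 < δ := by
    rw [hδ, sub_pos]
    exact one_div_lt_one_div_of_lt (by positivity) (by linarith)
  have hmain : ((n / ℓ : ℕ) : ℝ) - (cancelledIndices ℓ v.toWord).card - 3 ≤ certifyingQM ε v v := by
    have := le_homogenization_smallCountingQM (ℓ := ℓ) hℓ0 v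
    rw [hv] at this
    rw [certifyingQM, hv]
    exact this
  have hdiv : T / (1 + 3 * ε / 4) ≤ (n / ℓ : ℕ) + 1 := by
    have hb : (ℓ : ℝ) ≤ (1 + 3 * ε / 4) * (Real.log n / l) := by
      have h3 : (ℓ : ℝ) < (1 + ε / 2) * (Real.log n / l) + 1 := Nat.ceil_lt_add_one (by positivity)
      rw [div_le_iff₀ hε] at h1
      have h4 : 4 ≤ Real.log n / l * ε := by
        rw [div_mul_eq_mul_div, le_div_iff₀ hl]
        exact h1
      linarith
    have h5 : (n : ℝ) < ℓ * ((n / ℓ : ℕ) + 1) := by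
      exact_mod_cast Nat.lt_mul_div_succ n hℓ0
    have h6 : T = n / (Real.log n / l) := by rw [hT]; field_simp
    rw [h6, div_div, div_le_iff₀ (by positivity)]
    calc (n : ℝ) ≤ ℓ * ((n / ℓ : ℕ) + 1) := h5.le
      _ ≤ (1 + 3 * ε / 4) * (Real.log n / l) * ((n / ℓ : ℕ) + 1) := by gcongr
      _ = _ := by ring
  have hcr : ((cancelledIndices ℓ v.toWord).card : ℝ) ≤ 2 * (δ / 4 * T + 1) := by
    have h7 : (⌈δ / 4 * T⌉₊ : ℝ) < δ / 4 * T + 1 := Nat.ceil_lt_add_one (by positivity)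
    have h8 : ((cancelledIndices ℓ v.toWord).card : ℝ) < 2 * ⌈δ / 4 * T⌉₊ := by exact_mod_cast hc
    linarith
  have hlarge : 12 ≤ δ * T := by
    rw [hT, mul_div_assoc', le_div_iff₀ hlog]
    exact h2
  have hsplit : T / (1 + 3 * ε / 4) = 1 / (1 + ε) * T + δ * T := by
    rw [hδ]
    ring
  linarith

theorem certifies_of_le_certifyingQM (hk : 2 ≤ k) (hε : 0 < ε) (hn : 2 ≤ n)
    {v : FreeGroup (Fin k)} (hv : v ∈ commutator (FreeGroup (Fin k)))
    (h : 1 / (1 + ε) * (n * Real.log (2 * k - 1) / Real.log n) ≤ certifyingQM ε v v) :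
    0 < defect (certifyingQM ε v) ∧
      1 / (1 + ε) * ((n : ℝ) * Real.log (2 * k - 1) / (12 * Real.log n)) ≤
        certifyingQM ε v v / (2 * defect (certifyingQM ε v)) ∧
      certifyingQM ε v v / (2 * defect (certifyingQM ε v)) ≤ scl v := by
  have hl := log_two_mul_sub_one_pos hk
  have hlog : 0 < Real.log n := Real.log_pos (by exact_mod_cast hn)
  have hnr : (0 : ℝ) < n := by positivity
  have hpos : 0 < certifyingQM ε v v := lt_of_lt_of_le (by positivity) h
  have hqm : IsHomogeneousQuasimorphism (certifyingQM ε v) :=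
    isHomogeneousQuasimorphism_homogenization (isQuasimorphism_smallCountingQM _)
      (smallCountingQM_inv _)
  have hD : 0 < defect (certifyingQM ε v) := hqm.defect_pos hv hpos
  have hD6 : defect (certifyingQM ε v) ≤ 6 := defect_homogenization_smallCountingQM_le _
  refine ⟨hD, ?_, ?_⟩
  · calc 1 / (1 + ε) * ((n : ℝ) * Real.log (2 * k - 1) / (12 * Real.log n))
        = 1 / (1 + ε) * (n * Real.log (2 * k - 1) / Real.log n) / 12 := by
          field_simp
      _ ≤ certifyingQM ε v v / 12 := by gcongr
      _ ≤ _ := div_le_div_of_nonneg_left hpos.le (by positivity) (by linarith)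
  · rw [div_le_iff₀ (by positivity)]
    exact hqm.le_two_mul_defect_mul_scl hv

theorem ncard_commutatorSphere_pos (hk : 2 ≤ k) (m : ℕ) :
    0 < (commutatorSphere k (2 * m + 6)).ncard := by
  have h := pow_le_ncard_commutatorSphere hk m
  by_contra! h0
  rw [Nat.le_zero.1 h0, zero_mul] at h
  have : 0 < (2 * k - 1) ^ (2 * m) := by
    have : 0 < 2 * k - 1 := by omega
    positivity
  omega

/-- The proportion of words with many cancelled blocks among the words of length `n` in the
commutator subgroup is exponentially small. -/
theorem ncard_cancelled_le (hk : 2 ≤ k) (hε : 0 < ε) {η : ℝ} (hη : 0 < η) (hn6 : 6 ≤ n)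
    (heven : Even n)
    (h3 : 8 * Real.log 2 / (η * ε) ≤ Real.log n)
    (h4 : 4 * k * Real.log n ≤ η * ε * Real.log (2 * k - 1) / 8 * n) :
    ({v ∈ commutatorSphere k n | 2 * ⌈η * (n * Real.log (2 * k - 1) / Real.log n)⌉₊ ≤
        (cancelledIndices (blockLength k ε n) v.toWord).card}.ncard : ℝ) ≤
      4 * k * (2 * k - 1) ^ 6 * Real.exp (-(η * ε * Real.log (2 * k - 1) / 4 * n)) *
        (commutatorSphere k n).ncard := by
  classical
  have hl := log_two_mul_sub_one_pos hk
  have hq3 := three_le_two_mul_sub_one hk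
  have hlog : 0 < Real.log n := Real.log_pos (by exact_mod_cast (by omega : 1 < n))
  have hnr : (0 : ℝ) < n := by positivity
  have hkcast : ((2 * k - 1 : ℕ) : ℝ) = 2 * k - 1 := by
    rw [Nat.cast_sub (by omega)]
    push_cast
    ring
  set l := Real.log (2 * k - 1) with hldef
  set ℓ := blockLength k ε n with hℓ
  set r := ⌈η * (n * l / Real.log n)⌉₊ with hr
  set q : ℝ := 2 * k - 1 with hq
  set S : ℝ := ((commutatorSphere k n).ncard : ℝ) with hS
  have hℓ0 : 0 < ℓ := blockLength_pos hk hε (by omega)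
  set B : Set (FreeGroup (Fin k)) :=
    {v ∈ commutatorSphere k n | 2 * r ≤ (cancelledIndices ℓ v.toWord).card} with hB
  -- there are few reduced words with many cancelled blocks
  have hupper : (B.ncard : ℝ) * q ^ (r * ℓ) ≤ 2 * (2 ^ (n / ℓ) * n ^ r * (2 * k * q ^ n)) := by
    have : Nonempty (Fin k) := ⟨⟨0, by omega⟩⟩
    have h := card_filter_cancelledIndices_mul_le (α := Fin k) (r := r) hℓ0
      (by omega : n ≠ 0)
    rw [Fintype.card_fin] at h
    have hBle : B.ncard ≤ ((reducedWords (Fin k) n).filter fun L =>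
        2 * r ≤ (cancelledIndices ℓ L).card).card := by
      rw [← Set.ncard_coe_finset]
      refine Set.ncard_le_ncard_of_injOn FreeGroup.toWord ?_
        FreeGroup.toWord_injective.injOn (Finset.finite_toSet _)
      intro v hv
      exact Finset.mem_coe.2 (Finset.mem_filter.2
        ⟨mem_reducedWords.2 ⟨hv.1.1, FreeGroup.isReduced_toWord⟩, hv.2⟩)
    have h' := (Nat.mul_le_mul_right _ hBle).trans h
    have h'' : ((B.ncard * (2 * k - 1) ^ (r * ℓ) : ℕ) : ℝ) ≤
        (2 * (2 ^ (n / ℓ) * n ^ r * (2 * k * (2 * k - 1) ^ n)) : ℕ) := by exact_mod_cast h'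
    simpa only [Nat.cast_mul, Nat.cast_pow, hkcast, Nat.cast_ofNat] using h''
  -- the commutator subgroup contains many words
  have hlower : q ^ n ≤ S * n ^ (4 * k) * q ^ 6 := by
    obtain ⟨m, rfl⟩ : ∃ m, n = 2 * m + 6 := by
      obtain ⟨a, ha⟩ := heven
      exact ⟨a - 3, by omega⟩
    have h := pow_le_ncard_commutatorSphere hk m
    have h' : (((2 * k - 1) ^ (2 * m) : ℕ) : ℝ) ≤
        ((commutatorSphere k (2 * m + 6)).ncard * (m + 2) ^ (4 * k) : ℕ) := by exact_mod_cast h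
    simp only [Nat.cast_mul, Nat.cast_pow, hkcast] at h'
    rw [pow_add]
    have : ((m + 2 : ℕ) : ℝ) ^ (4 * k) ≤ ((2 * m + 6 : ℕ) : ℝ) ^ (4 * k) := by
      gcongr <;> omega
    calc q ^ (2 * m) * q ^ 6 ≤ S * ((m + 2 : ℕ) : ℝ) ^ (4 * k) * q ^ 6 := by gcongr
      _ ≤ _ := by gcongr
  -- each cancelled block gains a factor `n ^ (ε / 2)`
  have hgain : Real.exp (η * ε * l / 2 * n) * n ^ r ≤ q ^ (r * ℓ) := by
    have h5 : (n : ℝ) ^ (1 + ε / 2) ≤ q ^ ℓ := rpow_le_pow_blockLength hk (by omega)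
    have h6 : ((n : ℝ) ^ (1 + ε / 2)) ^ r ≤ q ^ (r * ℓ) := by
      rw [mul_comm r, pow_mul]
      gcongr
    refine le_trans ?_ h6
    rw [Real.rpow_add hnr, Real.rpow_one, mul_pow, mul_comm]
    gcongr
    rw [Real.rpow_def_of_pos hnr, ← Real.exp_nat_mul, Real.exp_le_exp]
    have h7 : η * (n * l / Real.log n) ≤ r := Nat.le_ceil _
    rw [← mul_div_assoc, div_le_iff₀ hlog] at h7
    nlinarith
  -- the choice of blocks and the passage to the commutator subgroup each cost at most the
  -- exponential of `η * ε * l / 8 * n`, a quarter of the exponent gained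
  have hfew : (2 : ℝ) ^ (n / ℓ) ≤ Real.exp (η * ε * l / 8 * n) := by
    rw [← Real.exp_log (show (0 : ℝ) < 2 by norm_num), ← Real.exp_nat_mul, Real.exp_le_exp]
    have h8 : ((n / ℓ : ℕ) : ℝ) ≤ n / ℓ := Nat.cast_div_le
    have hℓr : (0 : ℝ) < ℓ := by exact_mod_cast hℓ0
    have h9 : Real.log n / l ≤ ℓ := by
      have : (1 + ε / 2) * (Real.log n / l) ≤ ℓ := Nat.le_ceil _
      have h10 : 0 < Real.log n / l := by positivity
      nlinarith
    have h11 : 8 * Real.log 2 ≤ η * ε * l * ℓ := by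
      rw [div_le_iff₀ (by positivity)] at h3
      rw [div_le_iff₀ hl] at h9
      calc 8 * Real.log 2 ≤ Real.log n * (η * ε) := h3
        _ ≤ ℓ * l * (η * ε) := by gcongr
        _ = _ := by ring
    calc ((n / ℓ : ℕ) : ℝ) * Real.log 2 ≤ n / ℓ * Real.log 2 := by gcongr
      _ ≤ n / ℓ * (η * ε * l * ℓ / 8) := by gcongr; linarith
      _ = _ := by field_simp
  have hpoly : (n : ℝ) ^ (4 * k) ≤ Real.exp (η * ε * l / 8 * n) := by
    rw [← Real.exp_log hnr, ← Real.exp_nat_mul, Real.exp_log hnr, Real.exp_le_exp]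
    push_cast
    exact h4
  set x := Real.exp (η * ε * l / 8 * n) with hx
  have hx0 : 0 < x := Real.exp_pos _
  have hx4 : Real.exp (η * ε * l / 2 * n) = x ^ 4 := by
    rw [hx, ← Real.exp_nat_mul]
    congr 1
    push_cast
    ring
  have hx2 : Real.exp (-(η * ε * l / 4 * n)) = (x ^ 2)⁻¹ := by
    rw [hx, ← Real.exp_nat_mul, ← Real.exp_neg]
    congr 1
    push_cast
    ring
  have hS0 : 0 ≤ S := Nat.cast_nonneg _
  have hq0 : 0 < q := by linarith
  rw [hx4] at hgain
  have hfinal : (B.ncard : ℝ) * (x ^ 4 * n ^ r) ≤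
      4 * k * q ^ 6 * S * x ^ 2 * n ^ r :=
    calc (B.ncard : ℝ) * (x ^ 4 * n ^ r) ≤ B.ncard * q ^ (r * ℓ) := by gcongr
      _ ≤ 2 * (2 ^ (n / ℓ) * n ^ r * (2 * k * q ^ n)) := hupper
      _ ≤ 2 * (x * n ^ r * (2 * k * (S * x * q ^ 6))) := by
        gcongr
        exact hlower.trans (by gcongr)
      _ = _ := by ring
  rw [hx2]
  rw [← mul_assoc] at hfinal
  have hfinal' := le_of_mul_le_mul_right hfinal (by positivity)
  have : (B.ncard : ℝ) ≤ 4 * k * q ^ 6 * S * x ^ 2 / x ^ 4 := by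
    rw [le_div_iff₀ (by positivity)]
    exact hfinal'
  refine this.trans_eq ?_
  field_simp

theorem eventually_log_le_mul {c : ℝ} (hc : 0 < c) :
    ∀ᶠ n : ℕ in atTop, Real.log n ≤ c * n := by
  have h := (Real.isLittleO_log_id_atTop.comp_tendsto tendsto_natCast_atTop_atTop).def hc
  filter_upwards [h] with n hn
  simp only [Function.comp, id, Real.norm_eq_abs, Nat.abs_cast] at hn
  exact (le_abs_self _).trans hn

end Asymptotics

end RandomScl

open RandomScl in
theorem proposition5p4 (k : ℕ) (hk : 2 ≤ k) (ε : ℝ) (hε : 0 < ε) :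
    (∀ v : FreeGroup (Fin k), RandomScl.IsHomogeneousQuasimorphism (RandomScl.certifyingQM ε v)) ∧
    ∃ C : ℝ, 1 < C ∧ ∃ c : ℝ, 0 < c ∧ ∃ K : ℝ, ∃ N : ℕ, ∀ n : ℕ, N ≤ n → Even n →
      (RandomScl.commutatorSphere k n).Nonempty ∧
      1 - K * C ^ (-((n : ℝ) ^ c)) ≤
        RandomScl.uniformProb (RandomScl.commutatorSphere k n)
          {v | 0 < RandomScl.defect (RandomScl.certifyingQM ε v) ∧
            1 / (1 + ε) * ((n : ℝ) * Real.log (2 * k - 1) / (12 * Real.log n)) ≤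
              RandomScl.certifyingQM ε v v / (2 * RandomScl.defect (RandomScl.certifyingQM ε v)) ∧
            RandomScl.certifyingQM ε v v / (2 * RandomScl.defect (RandomScl.certifyingQM ε v)) ≤
              RandomScl.scl v} := by
  refine ⟨fun v => isHomogeneousQuasimorphism_homogenization (isQuasimorphism_smallCountingQM _)
    (smallCountingQM_inv _), ?_⟩
  have hl := log_two_mul_sub_one_pos hk
  set l := Real.log (2 * k - 1) with hldef
  set δ := 1 / (1 + 3 * ε / 4) - 1 / (1 + ε) with hδ
  have hδ0 : 0 < δ := by
    rw [hδ, sub_pos]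
    exact one_div_lt_one_div_of_lt (by positivity) (by linarith)
  have hη : 0 < δ / 4 := by positivity
  have hk0 : (0 : ℝ) < k := by positivity
  have hlogtop : Tendsto (fun n : ℕ => Real.log n) atTop atTop :=
    Real.tendsto_log_atTop.comp tendsto_natCast_atTop_atTop
  obtain ⟨N, hN⟩ := eventually_atTop.1
    ((eventually_ge_atTop 6).and ((hlogtop.eventually_ge_atTop (4 * l / ε)).and
    ((eventually_log_le_mul (c := δ * l / 12) (by positivity)).and
    ((hlogtop.eventually_ge_atTop (8 * Real.log 2 / (δ / 4 * ε))).and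
    (eventually_log_le_mul (c := δ / 4 * ε * l / 8 / (4 * k)) (by positivity))))))
  refine ⟨Real.exp (δ / 4 * ε * l / 4), Real.one_lt_exp_iff.2 (by positivity), 1, one_pos,
    4 * k * (2 * k - 1) ^ 6, N, fun n hn heven => ?_⟩
  obtain ⟨hn6, h1, h2, h3, h4⟩ := hN n hn
  have hSpos : 0 < (commutatorSphere k n).ncard := by
    obtain ⟨a, ha⟩ := heven
    obtain ⟨m, rfl⟩ : ∃ m, n = 2 * m + 6 := ⟨a - 3, by omega⟩
    exact ncard_commutatorSphere_pos hk m
  refine ⟨(Set.ncard_pos (finite_commutatorSphere k n)).1 hSpos, ?_⟩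
  have hSr : (0 : ℝ) < (commutatorSphere k n).ncard := by exact_mod_cast hSpos
  have hbad := ncard_cancelled_le hk hε hη hn6 heven h3 (by
    rw [div_mul_eq_mul_div, le_div_iff₀ (by positivity)] at h4
    linarith)
  set S := commutatorSphere k n with hS
  set B : Set (FreeGroup (Fin k)) :=
    {v ∈ S | 2 * ⌈δ / 4 * (n * l / Real.log n)⌉₊ ≤
        (cancelledIndices (blockLength k ε n) v.toWord).card} with hB
  have hcover : S.ncard ≤ (S ∩ {v | 0 < defect (certifyingQM ε v) ∧
      1 / (1 + ε) * ((n : ℝ) * l / (12 * Real.log n)) ≤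
        certifyingQM ε v v / (2 * defect (certifyingQM ε v)) ∧
      certifyingQM ε v v / (2 * defect (certifyingQM ε v)) ≤ scl v}).ncard + B.ncard := by
    have hfin : S.Finite := finite_commutatorSphere k n
    refine (Set.ncard_le_ncard ?_ ((hfin.inter_of_left _).union
      (hfin.subset fun v hv => hv.1))).trans (Set.ncard_union_le _ _)
    intro v hv
    by_cases hvB : v ∈ B
    · exact Or.inr hvB
    · refine Or.inl ⟨hv, certifies_of_le_certifyingQM hk hε (by omega) hv.2
        (le_certifyingQM hk hε (by omega) hδ h1 (by linarith) hv.1 ?_)⟩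
      by_contra! hcard
      exact hvB ⟨hv, hcard⟩
  have hcover' : (S.ncard : ℝ) ≤ (S ∩ {v | 0 < defect (certifyingQM ε v) ∧
      1 / (1 + ε) * ((n : ℝ) * l / (12 * Real.log n)) ≤
        certifyingQM ε v v / (2 * defect (certifyingQM ε v)) ∧
      certifyingQM ε v v / (2 * defect (certifyingQM ε v)) ≤ scl v}).ncard + B.ncard := by
    exact_mod_cast hcover
  rw [uniformProb, le_div_iff₀ hSr, Real.rpow_one, ← Real.exp_mul, mul_neg]
  linarith
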